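/- **Theorem.** Let $(\mathcal N,G)$ be a smooth Hausdorff Riemannian manifold without boundary (of finite dimension, or modelled on a Hilbert space, the norm $\|v\|:=\sqrt{G(v,v)}$ inducing the topology of each tangent space), with Levi-Civita connection $\nabla$ and exponential map $\exp$. Let $U\subset\mathcal N$, let $f$ be a real function that is twice differentiable at every point of $U$ (so it is defined near every point of $U$; for open $U$ this means a twice differentiable $f:U\to\mathbb R$), let $\operatorname{grad} f$ be its Riemannian gradient and $\operatorname{Hess} f(p)[v]:=\nabla_v \operatorname{grad} f$ its Riemannian Hessian. Let $x\in U$ and $L\in\mathbb R$. For $\Delta x\in T_x\mathcal N$ in the domain of $\exp_x$, let $\gamma:[0,1]\to\mathcal N$, $\gamma(t):=\exp_x(t\Delta x)$, and let $\mathcal P_{\alpha,\beta}:T_{\gamma(\alpha)}\mathcal N\to T_{\gamma(\beta)}\mathcal N$ be the parallel transport along $\gamma$. Assume that $$\bigl\|\mathcal P_{1,0}\operatorname{Hess} f(\exp_x(\Delta x))\,\mathcal P_{0,1}-\operatorname{Hess} f(x)\bigr\|\le L\,\|\Delta x\|$$ (operator norm with respect to $G$) for all such $\Delta x$ with $\gamma([0,1])\subset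 U$. Then $$\Bigl|f(\exp_x(\Delta x))-f(x)-G(\operatorname{grad} f(x),\Delta x)-\tfrac12 G(\operatorname{Hess} f(x)\Delta x,\Delta x)\Bigr|\le \frac L6\,\|\Delta x\|^3$$ for all $\Delta x$ in the domain of $\exp_x$ with $\gamma([0,1])\subset U$. In particular, if $U$ is convex in the sense that every geodesic segment with end points in $U$ is contained in $U$, then this estimate holds for all $\Delta x$ in the domain of $\exp_x$ with $\exp_x(\Delta x)\in U$. -/

import Mathlib

noncomputable section

namespace RiemTaylor

/-- The Christoffel symbols of the first kind at `y` of a metric `g` on (an open subset of) `E`, as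
a bilinear form in `(v, w)` for a fixed `u`: `½ (∂_v g(u, w) + ∂_u g(v, w) - ∂_w g(u, v))`. -/
def christoffelForm {E : Type*} [NormedAddCommGroup E] [NormedSpace ℝ E]
    (g : E → E →L[ℝ] E →L[ℝ] ℝ) (y u : E) : E →L[ℝ] E →L[ℝ] ℝ :=
  (1 / 2 : ℝ) • ((fderiv ℝ g y).flip u + fderiv ℝ g y u - ((fderiv ℝ g y).flip u).flip)

theorem christoffelForm_apply {E : Type*} [NormedAddCommGroup E] [NormedSpace ℝ E]
    (g : E → E →L[ℝ] E →L[ℝ] ℝ) (y u v w : E) :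
    christoffelForm g y u v w = (1 / 2 : ℝ) *
      (fderiv ℝ g y v u w + fderiv ℝ g y u v w - fderiv ℝ g y w u v) := by
  simp [christoffelForm]

end RiemTaylor

end

open Set Filter Bundle Manifold
open scoped Topology ContDiff InnerProductSpace

noncomputable section

namespace RiemTaylor

variable {E : Type*} [NormedAddCommGroup E] [NormedSpace ℝ E]
  {H : Type*} [TopologicalSpace H] (I : ModelWithCorners ℝ E H)
  {M : Type*} [TopologicalSpace M] [ChartedSpace H M] [IsManifold I ∞ M]

/-- The linear map `T_p M → E` giving the components of a tangent vector at `p` in the preferred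
chart around `x`; for `p` in the domain of that chart it is the derivative of the chart at `p`. -/
def chartCoord (x p : M) : TangentSpace I p →L[ℝ] E :=
  (trivializationAt E (TangentSpace I) x).continuousLinearMapAt ℝ p

/-- The inverse map `E → T_p M`, for `p` in the domain of the preferred chart around `x`. -/
def chartVec (x p : M) : E →L[ℝ] TangentSpace I p :=
  (trivializationAt E (TangentSpace I) x).symmL ℝ p

variable [RiemannianBundle (fun x : M => TangentSpace I x)]

/-- The metric in the preferred chart around `x`: the bilinear form `g_y(u, v)`, for `y` in the
target of the chart. -/
def chartMetric (x : M) (y : E) : E →L[ℝ] E →L[ℝ] ℝ :=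
  (innerSL ℝ : TangentSpace I ((extChartAt I x).symm y) →L[ℝ]
      TangentSpace I ((extChartAt I x).symm y) →L[ℝ] ℝ).bilinearComp
    (chartVec I x ((extChartAt I x).symm y)) (chartVec I x ((extChartAt I x).symm y))

/-- The Christoffel symbols of the first kind at the centre of the preferred chart around `x`, as a
bilinear form in `(v, w)` for a fixed `u`. -/
def christoffelFirst (x : M) (u : E) : E →L[ℝ] E →L[ℝ] ℝ :=
  christoffelForm (chartMetric I x) (extChartAt I x x) u

/-- The tangent spaces are complete for the norm of the metric, as this norm induces the topology
of the model space. -/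
instance completeSpace_tangentSpace [CompleteSpace E] (x : M) :
    CompleteSpace (TangentSpace I x) := by
  have h : ∀ (u₁ u₂ : UniformSpace E) (_ : @IsUniformAddGroup E u₁ _)
      (_ : @IsUniformAddGroup E u₂ _) (_ : u₁.toTopologicalSpace = u₂.toTopologicalSpace)
      (_ : @CompleteSpace E u₁), @CompleteSpace E u₂ := by
    intro u₁ u₂ h₁ h₂ h h'
    have h₃ : u₁ = u₂ := IsUniformAddGroup.ext h₁ h₂ (by rw [h])
    rwa [← h₃]
  exact h inferInstance (inferInstance : UniformSpace (TangentSpace I x)) inferInstance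
    (inferInstance : IsUniformAddGroup (TangentSpace I x)) rfl inferInstance

variable [CompleteSpace E]

/-- The Christoffel symbols of the Levi-Civita connection at `x`, in the preferred chart around
`x`: `⟪christoffel I x u v, w⟫ = ½ (∂_v g(u, w) + ∂_u g(v, w) - ∂_w g(u, v))` for all `w`. -/
def christoffel (x : M) (u : TangentSpace I x) : TangentSpace I x →L[ℝ] TangentSpace I x :=
  InnerProductSpace.continuousLinearMapOfBilin (𝕜 := ℝ)
    ((christoffelFirst I x (chartCoord I x x u)).bilinearComp
      (chartCoord I x x) (chartCoord I x x))

theorem inner_christoffel (x : M) (u v w : TangentSpace I x) :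
    ⟪christoffel I x u v, w⟫_ℝ = christoffelFirst I x (chartCoord I x x u)
      (chartCoord I x x v) (chartCoord I x x w) :=
  InnerProductSpace.continuousLinearMapOfBilin_apply _ v w

/-- The Levi-Civita covariant derivative `v ↦ ∇_v X` of a vector field `X` at `x`: in the preferred
chart around `x` it is `∂_v X + Γ(X, v)`. -/
def covDeriv (X : ∀ p : M, TangentSpace I p) (x : M) :
    TangentSpace I x →L[ℝ] TangentSpace I x :=
  (chartVec I x x).comp
      ((fderiv ℝ (fun y : E => chartCoord I x ((extChartAt I x).symm y) (X _))
        (extChartAt I x x)).comp (chartCoord I x x))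
    + christoffel I x (X x)

/-- The Riemannian gradient: `⟪grad f x, v⟫ = df_x(v)` for all `v ∈ T_x M`. -/
def grad (f : M → ℝ) (x : M) : TangentSpace I x :=
  (InnerProductSpace.toDual ℝ (TangentSpace I x)).symm (mfderiv I 𝓘(ℝ, ℝ) f x)

/-- The Riemannian Hessian `Hess f(x) v = ∇_v grad f`. -/
def hess (f : M → ℝ) (x : M) : TangentSpace I x →L[ℝ] TangentSpace I x :=
  covDeriv I (grad I f) x

/-- `f` is twice differentiable at `x`: it is differentiable near `x`, and its gradient is
differentiable at `x`. -/
def TwiceDifferentiableAt (f : M → ℝ) (x : M) : Prop :=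
  (∀ᶠ p in 𝓝 x, MDifferentiableAt I 𝓘(ℝ, ℝ) f p) ∧
    MDifferentiableAt I I.tangent (fun p => (⟨p, grad I f p⟩ : TangentBundle I M)) x

/-- The components of a vector field `V` along a curve `γ`, in the preferred chart around
`γ t`. -/
def coordAlong (γ : ℝ → M) (V : ∀ t, TangentSpace I (γ t)) (t s : ℝ) : E :=
  chartCoord I (γ t) (γ s) (V s)

/-- The velocity `γ'(t)` of a curve `γ : [0,1] → M` (one-sided at the end points). -/
def velocity (γ : ℝ → M) (t : ℝ) : TangentSpace I (γ t) :=
  mfderivWithin 𝓘(ℝ, ℝ) I γ (Icc 0 1) t (1 : ℝ)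

/-- The covariant derivative `(D/dt) V` of a vector field `V` along a curve `γ : [0,1] → M`: in
the preferred chart around `γ t` it is `V' + Γ(V, γ')`. -/
def covDerivAlong (γ : ℝ → M) (V : ∀ t, TangentSpace I (γ t)) (t : ℝ) : TangentSpace I (γ t) :=
  chartVec I (γ t) (γ t) (derivWithin (coordAlong I γ V t) (Icc 0 1) t)
    + christoffel I (γ t) (V t) (velocity I γ t)

/-- `γ : [0,1] → M` is a geodesic. -/
def IsGeodesic (γ : ℝ → M) : Prop :=
  ContMDiffOn 𝓘(ℝ, ℝ) I 2 γ (Icc 0 1) ∧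
    ∀ t ∈ Icc (0 : ℝ) 1, covDerivAlong I γ (velocity I γ) t = 0

/-- `V` is a parallel vector field along the curve `γ : [0,1] → M`. -/
def IsParallelAlong (γ : ℝ → M) (V : ∀ t, TangentSpace I (γ t)) : Prop :=
  ∀ t ∈ Icc (0 : ℝ) 1, DifferentiableWithinAt ℝ (coordAlong I γ V t) (Icc 0 1) t ∧
    covDerivAlong I γ V t = 0

/-- `P` sends each `v ∈ T_{γ α} M` to the value at `β` of a parallel field with value `v`
at `α`. -/
def IsParallelTransport (γ : ℝ → M) (α β : ℝ)
    (P : TangentSpace I (γ α) →L[ℝ] TangentSpace I (γ β)) : Prop :=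
  ∀ v, ∃ V : ∀ t, TangentSpace I (γ t), IsParallelAlong I γ V ∧ V α = v ∧ V β = P v

open Classical in
/-- Parallel transport `P_{α,β} : T_{γ α} M → T_{γ β} M` along `γ : [0,1] → M`, for
`α, β ∈ [0,1]`. -/
def parallelTransport (γ : ℝ → M) (α β : ℝ) :
    TangentSpace I (γ α) →L[ℝ] TangentSpace I (γ β) :=
  if h : ∃ P, IsParallelTransport I γ α β P then h.choose else 0

/-- `γ : [0,1] → M` is a geodesic with `γ 0 = x` and `γ' 0 = v`. -/
def IsGeodesicFrom (x : M) (v : TangentSpace I x) (γ : ℝ → M) : Prop :=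
  IsGeodesic I γ ∧ (⟨γ 0, velocity I γ 0⟩ : TangentBundle I M) = ⟨x, v⟩

/-- The domain of `exp_x`: those `v` for which the geodesic with initial velocity `v` exists
on `[0,1]`. -/
def expDomain (x : M) : Set (TangentSpace I x) :=
  {v | ∃ γ, IsGeodesicFrom I x v γ}

open Classical in
/-- The exponential map: `exp_x v = γ 1` for the geodesic `γ` with `γ 0 = x`, `γ' 0 = v`
(and the value `x` if `v` is outside the domain of `exp_x`). -/
def expMap (x : M) (v : TangentSpace I x) : M :=
  if h : ∃ γ, IsGeodesicFrom I x v γ then h.choose 1 else x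

/-- The geodesic `t ↦ exp_x (t v)`. -/
def expCurve (x : M) (v : TangentSpace I x) (t : ℝ) : M :=
  expMap I x (t • v)

/-- Every geodesic segment with end points in `U` is contained in `U`. -/
def IsGeodesicallyConvex (U : Set M) : Prop :=
  ∀ x ∈ U, ∀ v ∈ expDomain I x, expMap I x v ∈ U → ∀ t ∈ Icc (0 : ℝ) 1, expCurve I x v t ∈ U

/-- `Hess f` is Lipschitz at `x` with constant `L` along the geodesic segments in `U` from `x`:
for `γ t = exp_x (t v)` contained in `U`, the operator norm (with respect to the metric) of
`P_{1,0} ∘ Hess f(γ 1) ∘ P_{0,1} - Hess f(γ 0)` is at most `L ‖v‖`. Here `γ 0 = exp_x 0 = x` and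
`γ 1 = exp_x v`. -/
def HessLipschitzAt (f : M → ℝ) (U : Set M) (L : ℝ) (x : M) : Prop :=
  ∀ v ∈ expDomain I x, (∀ t ∈ Icc (0 : ℝ) 1, expCurve I x v t ∈ U) →
    ‖(parallelTransport I (expCurve I x v) 1 0).comp
        ((hess I f (expCurve I x v 1)).comp (parallelTransport I (expCurve I x v) 0 1))
      - hess I f (expCurve I x v 0)‖ ≤ L * ‖v‖

end RiemTaylor

end

/-! Let `c t = exp_x (t v)` and `φ = f ∘ c`. Then `φ' = ⟪grad f, c'⟫`, and since the Levi-Civita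
connection is compatible with the metric and `c'` is parallel, `φ'' = ⟪Hess f c', c'⟫`. Parallel
transport is isometric and takes `c' 0 = v` to `c' t`, so that the hypothesis on the Hessian,
applied to `t v`, gives `|φ'' t - φ'' 0| ≤ L ‖v‖ ^ 3 t`. Integrating twice yields the estimate. -/

noncomputable section

namespace RiemTaylor

set_option maxSynthPendingDepth 3

/-! ### Ordinary differential equations and Taylor bounds on intervals -/

section Calculus

variable {E F G : Type*} [NormedAddCommGroup E] [NormedSpace ℝ E]
  [NormedAddCommGroup F] [NormedSpace ℝ F] [NormedAddCommGroup G] [NormedSpace ℝ G]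

theorem hasDerivWithinAt_of_notMem_Icc {ψ : ℝ → E} {ψ' : E} {a b t : ℝ} (ht : t ∉ Icc a b) :
    HasDerivWithinAt ψ ψ' (Icc a b) t :=
  HasFDerivWithinAt.of_notMem_closure (by rwa [isClosed_Icc.closure_eq])

theorem hasDerivWithinAt_Ici_of_Icc {ψ : ℝ → E} {ψ' : E} {a b t : ℝ} (ht : t ∈ Ico a b)
    (h : HasDerivWithinAt ψ ψ' (Icc a b) t) : HasDerivWithinAt ψ ψ' (Ici t) t :=
  h.mono_of_mem_nhdsWithin (mem_of_superset (Icc_mem_nhdsGE ht.2) (Icc_subset_Icc_left ht.1))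

theorem hasDerivWithinAt_mul_left (r t : ℝ) (S : Set ℝ) :
    HasDerivWithinAt (fun s => r * s) r S t :=
  ((hasDerivWithinAt_id t S).const_mul r).congr_deriv (mul_one r)

theorem norm_sub_taylor_one_le {φ φ' : ℝ → E} {a b C t : ℝ}
    (hφ : ∀ s ∈ Icc a b, HasDerivWithinAt φ (φ' s) (Icc a b) s)
    (hC : ∀ s ∈ Icc a b, ‖φ' s - φ' a‖ ≤ C * (s - a)) (ht : t ∈ Icc a b) :
    ‖φ t - φ a - (t - a) • φ' a‖ ≤ C / 2 * (t - a) ^ 2 := by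
  have hderiv : ∀ s ∈ Icc a b,
      HasDerivWithinAt (fun s => φ s - φ a - (s - a) • φ' a) (φ' s - φ' a) (Icc a b) s :=
    fun s hs => (((hφ s hs).sub_const (φ a)).fun_sub
      (((hasDerivWithinAt_id s _).sub_const a).smul_const (φ' a))).congr_deriv (by simp)
  have hbound : ∀ s, HasDerivAt (fun s => C / 2 * (s - a) ^ 2) (C * (s - a)) s := fun s =>
    ((((hasDerivAt_id s).sub_const a).pow 2).const_mul (C / 2)).congr_deriv
      (by simp only [id]; push_cast; ring)
  exact image_norm_le_of_norm_deriv_right_le_deriv_boundary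
    (fun s hs => (hderiv s hs).continuousWithinAt)
    (fun s hs => hasDerivWithinAt_Ici_of_Icc hs (hderiv s (Ico_subset_Icc_self hs)))
    (by simp) hbound (fun s hs => hC s (Ico_subset_Icc_self hs)) ht

theorem norm_sub_taylor_two_le {φ φ' φ'' : ℝ → E} {a b C t : ℝ}
    (hφ : ∀ s ∈ Icc a b, HasDerivWithinAt φ (φ' s) (Icc a b) s)
    (hφ' : ∀ s ∈ Icc a b, HasDerivWithinAt φ' (φ'' s) (Icc a b) s)
    (hC : ∀ s ∈ Icc a b, ‖φ'' s - φ'' a‖ ≤ C * (s - a)) (ht : t ∈ Icc a b) :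
    ‖φ t - φ a - (t - a) • φ' a - ((t - a) ^ 2 / 2) • φ'' a‖ ≤ C / 6 * (t - a) ^ 3 := by
  have hderiv : ∀ s ∈ Icc a b,
      HasDerivWithinAt (fun s => φ s - φ a - (s - a) • φ' a - ((s - a) ^ 2 / 2) • φ'' a)
        (φ' s - φ' a - (s - a) • φ'' a) (Icc a b) s := fun s hs =>
    ((((hφ s hs).sub_const (φ a)).fun_sub
      (((hasDerivWithinAt_id s _).sub_const a).smul_const (φ' a))).fun_sub
      (((((hasDerivWithinAt_id s _).sub_const a).pow 2).div_const 2).smul_const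
        (φ'' a))).congr_deriv (by simp)
  have hbound : ∀ s, HasDerivAt (fun s => C / 6 * (s - a) ^ 3) (C / 2 * (s - a) ^ 2) s := fun s =>
    ((((hasDerivAt_id s).sub_const a).pow 3).const_mul (C / 6)).congr_deriv
      (by simp only [id]; push_cast; ring)
  exact image_norm_le_of_norm_deriv_right_le_deriv_boundary
    (fun s hs => (hderiv s hs).continuousWithinAt)
    (fun s hs => hasDerivWithinAt_Ici_of_Icc hs (hderiv s (Ico_subset_Icc_self hs)))
    (by simp) hbound
    (fun s hs => norm_sub_taylor_one_le hφ' hC (Ico_subset_Icc_self hs)) ht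

theorem Icc_induction_of_eventually {P : ℝ → ℝ → Prop} {a b : ℝ} (hab : a ≤ b)
    (hlocal : ∀ t ∈ Icc a b, ∃ O ∈ 𝓝 t, ∀ u v, u ≤ v → Icc u v ⊆ Icc a b → Icc u v ⊆ O → P u v)
    (htrans : ∀ u v w, u ≤ v → v ≤ w → P u v → P v w → P u w) : P a b := by
  choose O hO hP using fun t : Icc a b => hlocal t t.2
  obtain ⟨t, ht₀, hmono, ⟨m, hm⟩, hcover⟩ := exists_monotone_Icc_subset_open_cover_Icc hab
    (c := fun i => Subtype.val ⁻¹' interior (O i))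
    (fun i => isOpen_interior.preimage continuous_subtype_val)
    (fun i _ => mem_iUnion.2 ⟨i, mem_interior_iff_mem_nhds.2 (hO i)⟩)
  have hstep : ∀ n, P (t n) (t (n + 1)) := fun n => by
    obtain ⟨i, hi⟩ := hcover n
    have hsub : Icc (t n : ℝ) (t (n + 1)) ⊆ Icc a b := Icc_subset_Icc (t n).2.1 (t (n + 1)).2.2
    exact hP i _ _ (hmono n.le_succ) hsub fun s hs =>
      interior_subset (hi (show (⟨s, hsub hs⟩ : Icc a b) ∈ Icc (t n) (t (n + 1)) from hs))
  have hall : ∀ n, P a (t (n + 1)) := fun n => by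
    induction n with
    | zero => simpa only [ht₀] using hstep 0
    | succ n ih => exact htrans _ _ _ (t (n + 1)).2.1 (hmono n.succ.le_succ) ih (hstep (n + 1))
  simpa only [hm (m + 1) m.le_succ] using hall m

section ODE

variable [CompleteSpace E]

theorem exists_hasDerivWithinAt_linear {A : ℝ → E →L[ℝ] E} {a b c K : ℝ} (hc : c ∈ Icc a b)
    (hA : ContinuousOn A (Icc a b)) (hK : ∀ t ∈ Icc a b, ‖A t‖ ≤ K)
    (hlen : 2 * K * (b - a) ≤ 1) (w : E) :
    ∃ W : ℝ → E, W c = w ∧ ∀ t ∈ Icc a b, HasDerivWithinAt W (A t (W t)) (Icc a b) t := by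
  lift K to NNReal using (norm_nonneg _).trans (hK c hc)
  refine IsPicardLindelof.exists_eq_forall_mem_Icc_hasDerivWithinAt₀ (t₀ := ⟨c, hc⟩)
    (f := fun t x => A t x) (a := ‖w‖₊) (L := K * (2 * ‖w‖₊)) (K := K)
    ⟨fun t ht => ((A t).lipschitz.weaken (hK t ht)).lipschitzOnWith,
      fun x _ => hA.clm_apply continuousOn_const, fun t ht x hx => ?_, ?_⟩
  · have hx' : ‖x‖ ≤ 2 * ‖w‖ := by
      have hxw : ‖x - w‖ ≤ ‖w‖ := by simpa [dist_eq_norm] using hx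
      linarith [norm_le_norm_sub_add x w]
    exact (A t).le_of_opNorm_le_of_le (hK t ht) hx'
  · have hmax : max (b - c) (c - a) ≤ b - a :=
      max_le (by linarith [hc.1]) (by linarith [hc.2])
    calc (K * (2 * ‖w‖)) * max (b - c) (c - a)
        ≤ K * (2 * ‖w‖) * (b - a) := by gcongr
      _ = 2 * K * (b - a) * ‖w‖ := by ring
      _ ≤ 1 * ‖w‖ := by gcongr
      _ = ‖w‖ - 0 := by ring

theorem exists_nhds_forall_Icc_hasDerivWithinAt_linear {A : ℝ → E →L[ℝ] E} {S : Set ℝ} {t₀ : ℝ}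
    (hA : ∀ᶠ t in 𝓝[S] t₀, ContinuousWithinAt A S t) (ht₀ : t₀ ∈ S) :
    ∃ O ∈ 𝓝 t₀, ∀ a b, Icc a b ⊆ S → Icc a b ⊆ O → ∀ c ∈ Icc a b, ∀ w, ∃ W : ℝ → E, W c = w ∧
      ∀ t ∈ Icc a b, HasDerivWithinAt W (A t (W t)) (Icc a b) t := by
  set K := ‖A t₀‖ + 1 with hKdef
  have hK : 0 < K := by positivity
  have hbound : ∀ᶠ t in 𝓝[S] t₀, ‖A t‖ < K :=
    (hA.self_of_nhdsWithin ht₀).norm.eventually_lt_const (by simp [hKdef])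
  obtain ⟨O, hO, hOS⟩ := mem_nhdsWithin_iff_exists_mem_nhds_inter.1 (hA.and hbound)
  refine ⟨O ∩ Metric.ball t₀ (1 / (4 * K)), inter_mem hO (Metric.ball_mem_nhds _ (by positivity)),
    fun a b habS habO c hc w => ?_⟩
  have hlen : b - a ≤ 1 / (2 * K) := by
    have hle : a ≤ b := hc.1.trans hc.2
    have ha := (habO (left_mem_Icc.2 hle)).2
    have hb := (habO (right_mem_Icc.2 hle)).2
    rw [Metric.mem_ball, Real.dist_eq, abs_lt] at ha hb
    have hhalf : 1 / (2 * K) = 1 / (4 * K) + 1 / (4 * K) := by field_simp; norm_num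
    linarith
  refine exists_hasDerivWithinAt_linear hc
    (fun t ht => (hOS ⟨(habO ht).1, habS ht⟩).1.mono habS)
    (fun t ht => (hOS ⟨(habO ht).1, habS ht⟩).2.le) ?_ w
  calc 2 * K * (b - a) ≤ 2 * K * (1 / (2 * K)) := by gcongr
    _ = 1 := by field_simp

end ODE

theorem eventuallyEq_of_hasDerivWithinAt {X : E → E} {y z : ℝ → E} {a b t : ℝ}
    (hX : ContDiffAt ℝ 1 X (y t)) (ht : t ∈ Ico a b)
    (hy : ∀ᶠ s in 𝓝[Icc a b] t, HasDerivWithinAt y (X (y s)) (Icc a b) s)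
    (hz : ∀ᶠ s in 𝓝[Icc a b] t, HasDerivWithinAt z (X (z s)) (Icc a b) s)
    (hyz : y t = z t) : y =ᶠ[𝓝[≥] t] z := by
  have ht' : t ∈ Icc a b := Ico_subset_Icc_self ht
  obtain ⟨K, N, hN, hLip⟩ := hX.exists_lipschitzOnWith
  have hyN : ∀ᶠ s in 𝓝[Icc a b] t, y s ∈ N :=
    (hy.self_of_nhdsWithin ht').continuousWithinAt hN
  have hzN : ∀ᶠ s in 𝓝[Icc a b] t, z s ∈ N :=
    (hz.self_of_nhdsWithin ht').continuousWithinAt (hyz ▸ hN)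
  have hnhds : 𝓝[≥] t ≤ 𝓝[Icc a b] t :=
    nhdsWithin_le_iff.2 (mem_of_superset (Icc_mem_nhdsGE ht.2) (Icc_subset_Icc_left ht.1))
  have hall := hnhds (((hy.and hz).and (hyN.and hzN)).and self_mem_nhdsWithin)
  obtain ⟨c, htc, hc⟩ := mem_nhdsGE_iff_exists_Icc_subset.1 hall
  have hsub : Icc t c ⊆ Icc a b := fun s hs => (hc hs).2
  have hright {ψ : ℝ → E} {ψ' : E} {s : ℝ} (hs : s ∈ Ico t c)
      (h : HasDerivWithinAt ψ ψ' (Icc a b) s) : HasDerivWithinAt ψ ψ' (Ici s) s :=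
    hasDerivWithinAt_Ici_of_Icc hs (h.mono hsub)
  have heq : EqOn y z (Icc t c) := ODE_solution_unique_of_mem_Icc_right
    (v := fun _ => X) (s := fun _ => N) (fun _ _ => hLip)
    (fun s hs => ((hc hs).1.1.1.mono hsub).continuousWithinAt)
    (fun s hs => hright hs (hc (Ico_subset_Icc_self hs)).1.1.1)
    (fun s hs => (hc (Ico_subset_Icc_self hs)).1.2.1)
    (fun s hs => ((hc hs).1.1.2.mono hsub).continuousWithinAt)
    (fun s hs => hright hs (hc (Ico_subset_Icc_self hs)).1.1.2)
    (fun s hs => (hc (Ico_subset_Icc_self hs)).1.2.2) hyz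
  exact heq.eventuallyEq_of_mem (Icc_mem_nhdsGE htc)

end Calculus

/-! ### Christoffel symbols in a normed space -/

section Christoffel

variable {E F G : Type*} [NormedAddCommGroup E] [NormedSpace ℝ E]
  [NormedAddCommGroup F] [NormedSpace ℝ F] [NormedAddCommGroup G] [NormedSpace ℝ G]

theorem fderiv_apply_apply_symm {g : E → F →L[ℝ] F →L[ℝ] G} {y : E} (hg : DifferentiableAt ℝ g y)
    (hsymm : ∀ z u w, g z u w = g z w u) (a : E) (u w : F) :
    fderiv ℝ g y a u w = fderiv ℝ g y a w u := by
  have hderiv := fun u w : F =>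
    (hg.hasFDerivAt.clm_apply (hasFDerivAt_const u y)).clm_apply (hasFDerivAt_const w y)
  have heq := (hderiv u w).unique
    ((hderiv w u).congr_of_eventuallyEq (Eventually.of_forall fun z => hsymm z u w))
  simpa using DFunLike.congr_fun heq a

theorem hasDerivWithinAt_apply_apply {g : E → F →L[ℝ] F →L[ℝ] G} {y : ℝ → E} {V W : ℝ → F}
    {y' : E} {V' W' : F} {S : Set ℝ} {t : ℝ} (hg : DifferentiableAt ℝ g (y t))
    (hy : HasDerivWithinAt y y' S t) (hV : HasDerivWithinAt V V' S t)
    (hW : HasDerivWithinAt W W' S t) :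
    HasDerivWithinAt (fun s => g (y s) (V s) (W s))
      (fderiv ℝ g (y t) y' (V t) (W t) + g (y t) V' (W t) + g (y t) (V t) W') S t :=
  (((hg.hasFDerivAt.comp_hasDerivWithinAt t hy).clm_apply hV).clm_apply hW).congr_deriv (by simp)

theorem hasDerivWithinAt_fderiv_apply {τ : E → F} {y W : ℝ → E} {y' W' : E} {S : Set ℝ} {t : ℝ}
    (hτ : ContDiffAt ℝ 2 τ (y t)) (hy : HasDerivWithinAt y y' S t)
    (hW : HasDerivWithinAt W W' S t) :
    HasDerivWithinAt (fun s => fderiv ℝ τ (y s) (W s))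
      (fderiv ℝ (fderiv ℝ τ) (y t) y' (W t) + fderiv ℝ τ (y t) W') S t := by
  have hd : DifferentiableAt ℝ (fderiv ℝ τ) (y t) :=
    (hτ.fderiv_right (m := 1) (by norm_num)).differentiableAt (by norm_num)
  exact (hd.hasFDerivAt.comp_hasDerivWithinAt t hy).clm_apply hW

theorem christoffelForm_add_swap {g : E → E →L[ℝ] E →L[ℝ] ℝ} {y : E} (hg : DifferentiableAt ℝ g y)
    (hsymm : ∀ z u w, g z u w = g z w u) (a u w : E) :
    christoffelForm g y u a w + christoffelForm g y w a u = fderiv ℝ g y a u w := by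
  have hs := fderiv_apply_apply_symm hg hsymm
  rw [christoffelForm_apply, christoffelForm_apply, hs a w u, hs w a u, hs u a w]
  ring

theorem fderiv_pullback {g : F → F →L[ℝ] F →L[ℝ] G} {h : E → E →L[ℝ] E →L[ℝ] G} {τ : E → F} {y : E}
    (hτ : ContDiffAt ℝ 2 τ y) (hg : DifferentiableAt ℝ g (τ y)) (hh : DifferentiableAt ℝ h y)
    (heq : ∀ᶠ z in 𝓝 y, ∀ u w, h z u w = g (τ z) (fderiv ℝ τ z u) (fderiv ℝ τ z w)) (a b c : E) :
    fderiv ℝ h y a b c =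
      fderiv ℝ g (τ y) (fderiv ℝ τ y a) (fderiv ℝ τ y b) (fderiv ℝ τ y c) +
        g (τ y) (fderiv ℝ (fderiv ℝ τ) y a b) (fderiv ℝ τ y c) +
        g (τ y) (fderiv ℝ τ y b) (fderiv ℝ (fderiv ℝ τ) y a c) := by
  have hτ' : DifferentiableAt ℝ (fderiv ℝ τ) y :=
    (hτ.fderiv_right (m := 1) (by norm_num)).differentiableAt (by norm_num)
  have hDτ := fun b : E => hτ'.hasFDerivAt.clm_apply (hasFDerivAt_const b y)
  have hgτ : HasFDerivAt (fun z => g (τ z)) ((fderiv ℝ g (τ y)).comp (fderiv ℝ τ y)) y :=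
    hg.hasFDerivAt.comp y (hτ.differentiableAt (by norm_num)).hasFDerivAt
  have hpull := ((hgτ.clm_apply (hDτ b)).clm_apply (hDτ c)).congr_of_eventuallyEq
    (heq.mono fun z hz => hz b c)
  have hdirect := (hh.hasFDerivAt.clm_apply (hasFDerivAt_const b y)).clm_apply
    (hasFDerivAt_const c y)
  have hval := DFunLike.congr_fun (hdirect.unique hpull) a
  simp only [add_apply, ContinuousLinearMap.comp_apply, ContinuousLinearMap.flip_apply,
    ContinuousLinearMap.comp_zero, zero_add] at hval
  rw [hval]
  abel

theorem christoffelForm_pullback {g : F → F →L[ℝ] F →L[ℝ] ℝ} {h : E → E →L[ℝ] E →L[ℝ] ℝ}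
    {τ : E → F} {y : E} (hτ : ContDiffAt ℝ 2 τ y) (hg : DifferentiableAt ℝ g (τ y))
    (hh : DifferentiableAt ℝ h y) (hsymm : ∀ u w, g (τ y) u w = g (τ y) w u)
    (heq : ∀ᶠ z in 𝓝 y, ∀ u w, h z u w = g (τ z) (fderiv ℝ τ z u) (fderiv ℝ τ z w))
    (u v w : E) :
    christoffelForm h y u v w =
      christoffelForm g (τ y) (fderiv ℝ τ y u) (fderiv ℝ τ y v) (fderiv ℝ τ y w) +
        g (τ y) (fderiv ℝ (fderiv ℝ τ) y v u) (fderiv ℝ τ y w) := by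
  have hsymm₂ : IsSymmSndFDerivAt ℝ τ y := hτ.isSymmSndFDerivAt (by simp)
  have hD := fderiv_pullback hτ hg hh heq
  rw [christoffelForm_apply, christoffelForm_apply, hD v u w, hD u v w, hD w u v,
    hsymm₂ u v, hsymm₂ u w, hsymm₂ v w, hsymm (fderiv ℝ τ y v) (fderiv ℝ (fderiv ℝ τ) y w u)]
  ring

/-- `christoffelForm g y`, bundled as a continuous linear map in its first argument as well. -/
def christoffelTrilinear (g : E → E →L[ℝ] E →L[ℝ] ℝ) (y : E) : E →L[ℝ] E →L[ℝ] E →L[ℝ] ℝ :=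
  (1 / 2 : ℝ) • ((fderiv ℝ g y).flip + fderiv ℝ g y -
    ((ContinuousLinearMap.flipₗᵢ ℝ E E ℝ : (E →L[ℝ] E →L[ℝ] ℝ) ≃ₗᵢ[ℝ] _) :
      (E →L[ℝ] E →L[ℝ] ℝ) →L[ℝ] (E →L[ℝ] E →L[ℝ] ℝ)).comp (fderiv ℝ g y).flip)

theorem christoffelTrilinear_apply (g : E → E →L[ℝ] E →L[ℝ] ℝ) (y u : E) :
    christoffelTrilinear g y u = christoffelForm g y u := by
  ext v w
  simp [christoffelTrilinear, christoffelForm]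

theorem contDiffAt_christoffelTrilinear {g : E → E →L[ℝ] E →L[ℝ] ℝ} {y : E} {m n : WithTop ℕ∞}
    (hg : ContDiffAt ℝ n g y) (hmn : m + 1 ≤ n) : ContDiffAt ℝ m (christoffelTrilinear g) y := by
  have hderiv : ContDiffAt ℝ m (fderiv ℝ g) y := hg.fderiv_right hmn
  have hflip : ContDiffAt ℝ m (fun y => (fderiv ℝ g y).flip) y :=
    (ContinuousLinearMap.flipₗᵢ ℝ E E (E →L[ℝ] ℝ)).contDiff.contDiffAt.comp y hderiv
  exact ((hflip.add hderiv).sub (contDiffAt_const.clm_comp hflip)).const_smul (1 / 2 : ℝ)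

/-- The Christoffel symbols of the second kind `Γ(u, v)` of a metric `g` on (an open subset of) `E`.
They have this meaning only where the bilinear form `g y` is nondegenerate, as otherwise
`(g y).inverse = 0`. -/
def christoffelSecond (g : E → E →L[ℝ] E →L[ℝ] ℝ) (y : E) : E →L[ℝ] E →L[ℝ] E :=
  (ContinuousLinearMap.compL ℝ E (E →L[ℝ] ℝ) E (g y).inverse).comp (christoffelTrilinear g y)

theorem apply_christoffelSecond {g : E → E →L[ℝ] E →L[ℝ] ℝ} {y : E} (hg : (g y).IsInvertible)
    (u v : E) : g y (christoffelSecond g y u v) = christoffelForm g y u v := by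
  rw [← christoffelTrilinear_apply]
  exact hg.self_apply_inverse _

theorem contDiffAt_christoffelSecond [CompleteSpace E] {g : E → E →L[ℝ] E →L[ℝ] ℝ} {y : E}
    {m n : WithTop ℕ∞} (hg : ContDiffAt ℝ n g y) (hmn : m + 1 ≤ n) (hinv : (g y).IsInvertible) :
    ContDiffAt ℝ m (christoffelSecond g) y := by
  have hinverse : ContDiffAt ℝ m (fun y => (g y).inverse) y :=
    hinv.contDiffAt_map_inverse.comp y (hg.of_le (le_self_add.trans hmn))
  exact ((ContinuousLinearMap.contDiff _).contDiffAt.comp y hinverse).clm_comp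
    (contDiffAt_christoffelTrilinear hg hmn)

theorem fderiv_christoffelSecond {g : F → F →L[ℝ] F →L[ℝ] ℝ} {h : E → E →L[ℝ] E →L[ℝ] ℝ}
    {τ : E → F} {y : E} (hτ : ContDiffAt ℝ 2 τ y) (hτsurj : Function.Surjective (fderiv ℝ τ y))
    (hg : DifferentiableAt ℝ g (τ y)) (hginv : (g (τ y)).IsInvertible)
    (hsymm : ∀ u w, g (τ y) u w = g (τ y) w u)
    (hh : DifferentiableAt ℝ h y) (hhinv : (h y).IsInvertible)
    (heq : ∀ᶠ z in 𝓝 y, ∀ u w, h z u w = g (τ z) (fderiv ℝ τ z u) (fderiv ℝ τ z w)) (u v : E) :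
    fderiv ℝ τ y (christoffelSecond h y u v) =
      christoffelSecond g (τ y) (fderiv ℝ τ y u) (fderiv ℝ τ y v) +
        fderiv ℝ (fderiv ℝ τ) y v u := by
  refine hginv.injective (ContinuousLinearMap.ext fun w => ?_)
  obtain ⟨w, rfl⟩ := hτsurj w
  rw [← heq.self_of_nhds, apply_christoffelSecond hhinv,
    christoffelForm_pullback hτ hg hh hsymm heq, map_add, add_apply, apply_christoffelSecond hginv]

end Christoffel

/-! ### Tangent vectors, the metric and the Christoffel symbols in charts -/

section Charts

variable {E : Type*} [NormedAddCommGroup E] [NormedSpace ℝ E]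
  {H : Type*} [TopologicalSpace H] {I : ModelWithCorners ℝ E H}
  {M : Type*} [TopologicalSpace M] [ChartedSpace H M]

theorem extChartAt_symm_apply_of_mem {x p : M} (hp : p ∈ (chartAt H x).source) :
    (extChartAt I x).symm (extChartAt I x p) = p :=
  (extChartAt I x).left_inv (by rwa [extChartAt_source])

theorem eventually_extChartAt_symm_mem [I.Boundaryless] {x p : M}
    (hp : p ∈ (chartAt H x).source) {s : Set M} (hs : s ∈ 𝓝 p) :
    ∀ᶠ y in 𝓝 (extChartAt I x p), y ∈ (extChartAt I x).target ∧ (extChartAt I x).symm y ∈ s := by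
  have hp' : p ∈ (extChartAt I x).source := by rwa [extChartAt_source]
  exact inter_mem (extChartAt_target_mem_nhds' ((extChartAt I x).map_source hp'))
    ((continuousAt_extChartAt_symm' hp').preimage_mem_nhds
      (by rwa [extChartAt_symm_apply_of_mem hp]))

variable (I) in
/-- The change of coordinates from the preferred chart around `x₀` to the one around `x₁`. -/
def chartTransition (x₀ x₁ : M) : E → E :=
  extChartAt I x₁ ∘ (extChartAt I x₀).symm

theorem chartTransition_apply {x₀ x₁ p : M} (hp : p ∈ (chartAt H x₀).source) :
    chartTransition I x₀ x₁ (extChartAt I x₀ p) = extChartAt I x₁ p := by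
  rw [chartTransition, Function.comp_apply, extChartAt_symm_apply_of_mem hp]

theorem contDiffAt_chartTransition [I.Boundaryless] {n : WithTop ℕ∞} [IsManifold I n M]
    {x₀ x₁ p : M} (h₀ : p ∈ (chartAt H x₀).source) (h₁ : p ∈ (chartAt H x₁).source) :
    ContDiffAt ℝ n (chartTransition I x₀ x₁) (extChartAt I x₀ p) := by
  have h := contDiffWithinAt_ext_coord_change (I := I) (n := n) x₁ x₀ (y := extChartAt I x₀ p)
    (by rw [ext_coord_change_source]
        exact ⟨chartAt H x₀ p, by simp [h₀, h₁], rfl⟩)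
  rwa [I.range_eq_univ, contDiffWithinAt_univ] at h

variable [IsManifold I ∞ M]

theorem chartVec_chartCoord {x p : M} (hp : p ∈ (chartAt H x).source) (v : TangentSpace I p) :
    chartVec I x p (chartCoord I x p v) = v :=
  (trivializationAt E (TangentSpace I) x).symmL_continuousLinearMapAt (R := ℝ) hp v

theorem chartCoord_chartVec {x p : M} (hp : p ∈ (chartAt H x).source) (u : E) :
    chartCoord I x p (chartVec I x p u) = u :=
  (trivializationAt E (TangentSpace I) x).continuousLinearMapAt_symmL (R := ℝ) hp u

theorem chartCoord_injective {x p : M} (hp : p ∈ (chartAt H x).source) :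
    Function.Injective (chartCoord I x p) :=
  Function.LeftInverse.injective (chartVec_chartCoord hp)

theorem chartCoord_eq_fderiv [I.Boundaryless] {x₀ x₁ p : M} (h₀ : p ∈ (chartAt H x₀).source)
    (h₁ : p ∈ (chartAt H x₁).source) (v : TangentSpace I p) :
    chartCoord I x₁ p v =
      fderiv ℝ (chartTransition I x₀ x₁) (extChartAt I x₀ p) (chartCoord I x₀ p v) := by
  have hcoord {x : M} (h : p ∈ (chartAt H x).source) :
      chartCoord I x p = tangentCoordChange I p x p :=
    TangentBundle.continuousLinearMapAt_trivializationAt_eq_core h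
  have hderiv : fderiv ℝ (chartTransition I x₀ x₁) (extChartAt I x₀ p) =
      tangentCoordChange I x₀ x₁ p := by
    rw [tangentCoordChange_def, I.range_eq_univ, fderivWithin_univ]
    rfl
  rw [hderiv, hcoord h₀, hcoord h₁]
  exact (tangentCoordChange_comp (I := I) (v := v)
    ⟨⟨mem_extChartAt_source p, by rwa [extChartAt_source]⟩, by rwa [extChartAt_source]⟩).symm

theorem surjective_fderiv_chartTransition [I.Boundaryless] {x₀ x₁ p : M}
    (h₀ : p ∈ (chartAt H x₀).source) (h₁ : p ∈ (chartAt H x₁).source) :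
    Function.Surjective (fderiv ℝ (chartTransition I x₀ x₁) (extChartAt I x₀ p)) := fun u =>
  ⟨chartCoord I x₀ p (chartVec I x₁ p u), by
    rw [← chartCoord_eq_fderiv h₀ h₁, chartCoord_chartVec h₁]⟩

theorem differentiableAt_chartCoord_section [I.Boundaryless] {X : ∀ p : M, TangentSpace I p}
    {x : M} (hX : MDifferentiableAt I I.tangent (fun p => (⟨p, X p⟩ : TangentBundle I M)) x) :
    DifferentiableAt ℝ (fun y : E => chartCoord I x ((extChartAt I x).symm y) (X _))
      (extChartAt I x x) := by
  have hsection : MDifferentiableAt I 𝓘(ℝ, E)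
      (fun p => (trivializationAt E (TangentSpace I) x (⟨p, X p⟩ : TangentBundle I M)).2) x :=
    ((mdifferentiableAt_totalSpace I _).1 hX).2
  have hsymm : MDifferentiableAt 𝓘(ℝ, E) I (extChartAt I x).symm (extChartAt I x x) :=
    ((contMDiffOn_extChartAt_symm (n := ∞) x).contMDiffAt
      (extChartAt_target_mem_nhds x)).mdifferentiableAt (by simp)
  have hcomp := (MDifferentiableAt.comp_of_eq (x := extChartAt I x x) (y := x) hsection hsymm
    (extChartAt_to_inv x)).differentiableAt
  refine hcomp.congr_of_eventuallyEq ?_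
  filter_upwards [eventually_extChartAt_symm_mem (I := I) (mem_chart_source H x)
    ((chartAt H x).open_source.mem_nhds (mem_chart_source H x))] with y hy
    using Trivialization.continuousLinearMapAt_apply_of_mem ℝ _ hy.2 _

section Metric

variable [RiemannianBundle (fun x : M => TangentSpace I x)]

theorem chartMetric_eq_inner {x p : M} (hp : p ∈ (chartAt H x).source) (u w : E) :
    chartMetric I x (extChartAt I x p) u w = ⟪chartVec I x p u, chartVec I x p w⟫_ℝ := by
  have hcongr : ∀ q, q = p →
      ⟪chartVec I x q u, chartVec I x q w⟫_ℝ = ⟪chartVec I x p u, chartVec I x p w⟫_ℝ := by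
    rintro q rfl
    rfl
  exact hcongr _ (extChartAt_symm_apply_of_mem hp)

theorem inner_eq_chartMetric {x p : M} (hp : p ∈ (chartAt H x).source) (v w : TangentSpace I p) :
    ⟪v, w⟫_ℝ = chartMetric I x (extChartAt I x p) (chartCoord I x p v) (chartCoord I x p w) := by
  rw [chartMetric_eq_inner hp, chartVec_chartCoord hp, chartVec_chartCoord hp]

theorem chartMetric_symm (x : M) (y u w : E) : chartMetric I x y u w = chartMetric I x y w u :=
  real_inner_comm (chartVec I x ((extChartAt I x).symm y) w)
    (chartVec I x ((extChartAt I x).symm y) u)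

theorem chartMetric_transition [I.Boundaryless] {x₀ x₁ p : M} (h₀ : p ∈ (chartAt H x₀).source)
    (h₁ : p ∈ (chartAt H x₁).source) (u w : E) :
    chartMetric I x₀ (extChartAt I x₀ p) u w =
      chartMetric I x₁ (chartTransition I x₀ x₁ (extChartAt I x₀ p))
        (fderiv ℝ (chartTransition I x₀ x₁) (extChartAt I x₀ p) u)
        (fderiv ℝ (chartTransition I x₀ x₁) (extChartAt I x₀ p) w) := by
  rw [chartTransition_apply h₀, chartMetric_eq_inner h₀, inner_eq_chartMetric h₁,
    chartCoord_eq_fderiv h₀ h₁, chartCoord_eq_fderiv h₀ h₁, chartCoord_chartVec h₀,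
    chartCoord_chartVec h₀]

theorem isInvertible_chartMetric [CompleteSpace E] {x p : M} (hp : p ∈ (chartAt H x).source) :
    (chartMetric I x (extChartAt I x p)).IsInvertible := by
  let e : E ≃L[ℝ] TangentSpace I p := ContinuousLinearEquiv.equivOfInverse (chartVec I x p)
    (chartCoord I x p) (chartCoord_chartVec hp) (chartVec_chartCoord hp)
  refine ⟨(e.trans (InnerProductSpace.toDual ℝ (TangentSpace I p)).toContinuousLinearEquiv).trans
    (e.symm.arrowCongr (ContinuousLinearEquiv.refl ℝ ℝ)), ?_⟩
  ext u w
  rw [chartMetric_eq_inner hp]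
  rfl

theorem contDiffAt_chartMetric [I.Boundaryless] {n : WithTop ℕ∞} [ENat.LEInfty n]
    [IsContMDiffRiemannianBundle I n E (fun x : M => TangentSpace I x)]
    {x p : M} (hp : p ∈ (chartAt H x).source) :
    ContDiffAt ℝ n (chartMetric I x) (extChartAt I x p) := by
  obtain ⟨g, hg, hgi⟩ := ‹IsContMDiffRiemannianBundle I n E (fun x : M => TangentSpace I x)›.1
  have hsection := (Trivialization.contMDiffAt_section_iff (trivializationAt (E →L[ℝ] E →L[ℝ] ℝ)
    (fun x : M => TangentSpace I x →L[ℝ] TangentSpace I x →L[ℝ] ℝ) x) (x₀ := p)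
    (by simpa using hp)).1 (hg p)
  have hsymm : ContMDiffAt 𝓘(ℝ, E) I n (extChartAt I x).symm (extChartAt I x p) :=
    (contMDiffOn_extChartAt_symm x).contMDiffAt
      (extChartAt_target_mem_nhds' ((extChartAt I x).map_source (by rwa [extChartAt_source])))
  refine (hsection.comp_of_eq hsymm
    (extChartAt_symm_apply_of_mem hp)).contDiffAt.congr_of_eventuallyEq ?_
  filter_upwards [eventually_extChartAt_symm_mem hp ((chartAt H x).open_source.mem_nhds hp)]
    with y ⟨_, hy⟩
  ext u w
  have hbase : (extChartAt I x).symm y ∈ (trivializationAt E (TangentSpace I) x).baseSet := hy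
  have hvec : ∀ u, chartVec I x ((extChartAt I x).symm y) u =
      (trivializationAt E (TangentSpace I) x).symm ((extChartAt I x).symm y) u :=
    Trivialization.symmL_apply _ hbase
  simp only [Function.comp_apply, hom_trivializationAt_apply]
  rw [inCoordinates_apply_eq₂ hbase hbase (by simp)]
  refine (hgi _ (chartVec I x _ u) (chartVec I x _ w)).trans ?_
  rw [hvec, hvec]
  simp

variable (I) in
/-- The Christoffel symbols `Γ(u, v)` of the Levi-Civita connection in the preferred chart around
`x`, at an arbitrary point of the target of that chart. -/
def chartChristoffel (x : M) : E → E →L[ℝ] E →L[ℝ] E :=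
  christoffelSecond (chartMetric I x)

variable [CompleteSpace E]

theorem chartMetric_chartChristoffel {x p : M} (hp : p ∈ (chartAt H x).source) (u v : E) :
    chartMetric I x (extChartAt I x p) (chartChristoffel I x (extChartAt I x p) u v) =
      christoffelForm (chartMetric I x) (extChartAt I x p) u v :=
  apply_christoffelSecond (isInvertible_chartMetric hp) u v

theorem chartCoord_christoffel (p : M) (u v : TangentSpace I p) :
    chartCoord I p p (christoffel I p u v) =
      chartChristoffel I p (extChartAt I p p) (chartCoord I p p u) (chartCoord I p p v) := by
  have hp := mem_chart_source H p
  refine (isInvertible_chartMetric (I := I) hp).injective (ContinuousLinearMap.ext fun w => ?_)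
  have h := inner_christoffel I p u v (chartVec I p p w)
  rw [inner_eq_chartMetric hp, chartCoord_chartVec hp] at h
  rw [h, chartMetric_chartChristoffel hp, christoffelFirst]

variable [I.Boundaryless]

theorem contDiffAt_chartChristoffel {m n : WithTop ℕ∞} [ENat.LEInfty n]
    [IsContMDiffRiemannianBundle I n E (fun x : M => TangentSpace I x)]
    (hmn : m + 1 ≤ n) {x p : M} (hp : p ∈ (chartAt H x).source) :
    ContDiffAt ℝ m (chartChristoffel I x) (extChartAt I x p) :=
  contDiffAt_christoffelSecond (contDiffAt_chartMetric hp) hmn (isInvertible_chartMetric hp)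

theorem fderiv_chartChristoffel [IsContMDiffRiemannianBundle I 1 E (fun x : M => TangentSpace I x)]
    {x₀ x₁ p : M} (h₀ : p ∈ (chartAt H x₀).source) (h₁ : p ∈ (chartAt H x₁).source) (u v : E) :
    fderiv ℝ (chartTransition I x₀ x₁) (extChartAt I x₀ p)
        (chartChristoffel I x₀ (extChartAt I x₀ p) u v) =
      chartChristoffel I x₁ (extChartAt I x₁ p)
          (fderiv ℝ (chartTransition I x₀ x₁) (extChartAt I x₀ p) u)
          (fderiv ℝ (chartTransition I x₀ x₁) (extChartAt I x₀ p) v) +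
        fderiv ℝ (fderiv ℝ (chartTransition I x₀ x₁)) (extChartAt I x₀ p) v u := by
  have hτ := chartTransition_apply (I := I) (x₁ := x₁) h₀
  have hoverlap : (chartAt H x₀).source ∩ (chartAt H x₁).source ∈ 𝓝 p :=
    ((chartAt H x₀).open_source.inter (chartAt H x₁).open_source).mem_nhds ⟨h₀, h₁⟩
  have hdiff {x : M} (h : p ∈ (chartAt H x).source) :
      DifferentiableAt ℝ (chartMetric I x) (extChartAt I x p) :=
    (contDiffAt_chartMetric (n := 1) h).differentiableAt one_ne_zero
  rw [← hτ]
  exact fderiv_christoffelSecond (contDiffAt_chartTransition h₀ h₁)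
    (surjective_fderiv_chartTransition h₀ h₁) (hτ ▸ hdiff h₁)
    (hτ ▸ isInvertible_chartMetric h₁) (chartMetric_symm _ _) (hdiff h₀)
    (isInvertible_chartMetric h₀)
    ((eventually_extChartAt_symm_mem h₀ hoverlap).mono fun z ⟨hz, hz₀, hz₁⟩ u w => by
      rw [← (extChartAt I x₀).right_inv hz]
      exact chartMetric_transition hz₀ hz₁ u w) u v

end Metric

end Charts

/-! ### Covariant derivatives along curves -/

section Along

variable {E : Type*} [NormedAddCommGroup E] [NormedSpace ℝ E]
  {H : Type*} [TopologicalSpace H] {I : ModelWithCorners ℝ E H}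
  {M : Type*} [TopologicalSpace M] [ChartedSpace H M] [IsManifold I ∞ M]
  {γ : ℝ → M} {V W : ∀ t, TangentSpace I (γ t)} {x₀ x₁ : M} {S : Set ℝ} {t : ℝ}

theorem hasDerivWithinAt_extChartAt_comp
    (hγ : MDifferentiableWithinAt 𝓘(ℝ, ℝ) I γ (Icc 0 1) t) (h₀ : γ t ∈ (chartAt H x₀).source) :
    HasDerivWithinAt (fun s => extChartAt I x₀ (γ s)) (chartCoord I x₀ (γ t) (velocity I γ t))
      (Icc 0 1) t := by
  have hchart : HasMFDerivAt I 𝓘(ℝ, E) (extChartAt I x₀) (γ t) (chartCoord I x₀ (γ t)) := by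
    rw [chartCoord, TangentBundle.continuousLinearMapAt_trivializationAt h₀]
    exact (mdifferentiableAt_extChartAt h₀).hasMFDerivAt
  have hcomp : HasFDerivWithinAt (fun s => extChartAt I x₀ (γ s)) ((chartCoord I x₀ (γ t)).comp
      (mfderivWithin 𝓘(ℝ, ℝ) I γ (Icc 0 1) t) : ℝ →L[ℝ] E) (Icc 0 1) t :=
    (hchart.comp_hasMFDerivWithinAt t hγ.hasMFDerivWithinAt).hasFDerivWithinAt
  exact hcomp.hasDerivWithinAt

theorem eventually_mem_chartAt_source (hγ : ContinuousWithinAt γ S t)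
    (h₀ : γ t ∈ (chartAt H x₀).source) : ∀ᶠ s in 𝓝[S] t, γ s ∈ (chartAt H x₀).source :=
  hγ ((chartAt H x₀).open_source.mem_nhds h₀)

theorem hasDerivWithinAt_chartCoord_transition [I.Boundaryless] {y' W' : E}
    (hγ : ContinuousWithinAt γ S t)
    (h₀ : γ t ∈ (chartAt H x₀).source) (h₁ : γ t ∈ (chartAt H x₁).source)
    (hy : HasDerivWithinAt (fun s => extChartAt I x₀ (γ s)) y' S t)
    (hV : HasDerivWithinAt (fun s => chartCoord I x₀ (γ s) (V s)) W' S t) :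
    HasDerivWithinAt (fun s => chartCoord I x₁ (γ s) (V s))
      (fderiv ℝ (fderiv ℝ (chartTransition I x₀ x₁)) (extChartAt I x₀ (γ t)) y'
          (chartCoord I x₀ (γ t) (V t)) +
        fderiv ℝ (chartTransition I x₀ x₁) (extChartAt I x₀ (γ t)) W') S t := by
  have hderiv := hasDerivWithinAt_fderiv_apply (τ := chartTransition I x₀ x₁)
    (y := fun s => extChartAt I x₀ (γ s)) (W := fun s => chartCoord I x₀ (γ s) (V s))
    (contDiffAt_chartTransition h₀ h₁) hy hV
  refine hderiv.congr_of_eventuallyEq ?_ (chartCoord_eq_fderiv h₀ h₁ (V t))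
  filter_upwards [eventually_mem_chartAt_source hγ h₀, eventually_mem_chartAt_source hγ h₁]
    with s hs₀ hs₁ using chartCoord_eq_fderiv hs₀ hs₁ (V s)

variable [RiemannianBundle (fun x : M => TangentSpace I x)]

variable (I) in
/-- In the preferred chart around `x₀`, the vector field `V` along `γ` has covariant derivative `a`
at `t` within `S`: in coordinates, `V' = a - Γ(V, γ')`. -/
def HasChartCovDerivWithinAt (γ : ℝ → M) (V : ∀ t, TangentSpace I (γ t)) (x₀ : M) {t : ℝ}
    (a : TangentSpace I (γ t)) (S : Set ℝ) : Prop :=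
  HasDerivWithinAt (fun s => chartCoord I x₀ (γ s) (V s))
    (chartCoord I x₀ (γ t) a - chartChristoffel I x₀ (extChartAt I x₀ (γ t))
      (chartCoord I x₀ (γ t) (V t)) (chartCoord I x₀ (γ t) (velocity I γ t))) S t

variable (I) in
/-- The vector field `V` along `γ : [0,1] → M` has covariant derivative `a` at `t` within
`S ⊆ [0,1]`. The velocity of `γ` in this notion is the one within `[0,1]`, whatever `S` is. -/
def HasCovDerivWithinAt (γ : ℝ → M) (V : ∀ t, TangentSpace I (γ t)) {t : ℝ}
    (a : TangentSpace I (γ t)) (S : Set ℝ) : Prop :=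
  HasChartCovDerivWithinAt I γ V (γ t) a S

section CongrGlue

variable {a b : TangentSpace I (γ t)}

theorem HasCovDerivWithinAt.congr (hV : HasCovDerivWithinAt I γ V a S)
    (heq : ∀ s ∈ S, W s = V s) (ht : t ∈ S) : HasCovDerivWithinAt I γ W a S := by
  unfold HasCovDerivWithinAt HasChartCovDerivWithinAt at hV ⊢
  rw [heq t ht]
  exact hV.congr_of_mem (fun s hs => by rw [heq s hs]) ht

theorem HasCovDerivWithinAt.union {S' : Set ℝ} (hV : HasCovDerivWithinAt I γ V a S)
    (hV' : HasCovDerivWithinAt I γ V a S') : HasCovDerivWithinAt I γ V a (S ∪ S') :=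
  HasDerivWithinAt.union hV hV'

theorem hasCovDerivWithinAt_of_notMem_Icc {c d : ℝ} (ht : t ∉ Icc c d) :
    HasCovDerivWithinAt I γ V a (Icc c d) :=
  hasDerivWithinAt_of_notMem_Icc ht

theorem HasCovDerivWithinAt.add (hV : HasCovDerivWithinAt I γ V a S)
    (hW : HasCovDerivWithinAt I γ W b S) :
    HasCovDerivWithinAt I γ (fun s => V s + W s) (a + b) S := by
  unfold HasCovDerivWithinAt HasChartCovDerivWithinAt at *
  simp only [map_add, add_apply]
  exact (hV.fun_add hW).congr_deriv (by abel)

theorem HasCovDerivWithinAt.const_smul (hV : HasCovDerivWithinAt I γ V a S) (c : ℝ) :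
    HasCovDerivWithinAt I γ (fun s => c • V s) (c • a) S := by
  unfold HasCovDerivWithinAt HasChartCovDerivWithinAt at *
  simp only [map_smul, smul_apply, ← smul_sub]
  exact hV.fun_const_smul c

end CongrGlue

variable [CompleteSpace E] {a b : TangentSpace I (γ t)}

theorem chartCoord_covDerivAlong :
    chartCoord I (γ t) (γ t) (covDerivAlong I γ V t) =
      derivWithin (coordAlong I γ V t) (Icc 0 1) t +
        chartChristoffel I (γ t) (extChartAt I (γ t) (γ t)) (chartCoord I (γ t) (γ t) (V t))
          (chartCoord I (γ t) (γ t) (velocity I γ t)) := by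
  rw [covDerivAlong, map_add, chartCoord_chartVec (mem_chart_source H _), chartCoord_christoffel]

theorem hasCovDerivWithinAt_Icc_iff (ht : t ∈ Icc (0 : ℝ) 1) :
    HasCovDerivWithinAt I γ V a (Icc 0 1) ↔
      DifferentiableWithinAt ℝ (coordAlong I γ V t) (Icc 0 1) t ∧ covDerivAlong I γ V t = a := by
  constructor
  · intro hV
    refine ⟨hV.differentiableWithinAt, chartCoord_injective (mem_chart_source H _) ?_⟩
    have hderiv : derivWithin (coordAlong I γ V t) (Icc 0 1) t = _ :=
      HasDerivWithinAt.derivWithin hV (uniqueDiffOn_Icc_zero_one t ht)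
    rw [chartCoord_covDerivAlong, hderiv, sub_add_cancel]
  · rintro ⟨hV, rfl⟩
    exact hV.hasDerivWithinAt.congr_deriv
      (by rw [chartCoord_covDerivAlong, add_sub_cancel_right])

theorem isParallelAlong_iff : IsParallelAlong I γ V ↔
    ∀ t ∈ Icc (0 : ℝ) 1, HasCovDerivWithinAt I γ V (0 : TangentSpace I (γ t)) (Icc 0 1) :=
  forall₂_congr fun _ ht => (hasCovDerivWithinAt_Icc_iff ht).symm

variable [I.Boundaryless]

theorem hasCovDerivWithinAt_comp {X : ∀ p : M, TangentSpace I p}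
    (hX : MDifferentiableAt I I.tangent (fun p => (⟨p, X p⟩ : TangentBundle I M)) (γ t))
    (hγ : MDifferentiableWithinAt 𝓘(ℝ, ℝ) I γ (Icc 0 1) t) :
    HasCovDerivWithinAt I γ (fun s => X (γ s)) (covDeriv I X (γ t) (velocity I γ t))
      (Icc 0 1) := by
  have hp := mem_chart_source H (γ t)
  have hderiv := (differentiableAt_chartCoord_section hX).hasFDerivAt.comp_hasDerivWithinAt
    (f := fun s => extChartAt I (γ t) (γ s)) t (hasDerivWithinAt_extChartAt_comp hγ hp)
  have hcoord : ∀ s, γ s ∈ (chartAt H (γ t)).source → chartCoord I (γ t) (γ s) (X (γ s)) =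
      chartCoord I (γ t) ((extChartAt I (γ t)).symm (extChartAt I (γ t) (γ s))) (X _) :=
    fun s hs => by rw [extChartAt_symm_apply_of_mem hs]
  refine (hderiv.congr_of_eventuallyEq
    ((eventually_mem_chartAt_source hγ.continuousWithinAt hp).mono hcoord)
    (hcoord t hp)).congr_deriv ?_
  rw [covDeriv, add_apply, map_add, chartCoord_christoffel, add_sub_cancel_right]
  exact (chartCoord_chartVec hp _).symm

variable [IsContMDiffRiemannianBundle I 1 E (fun x : M => TangentSpace I x)]

theorem HasChartCovDerivWithinAt.change_chart (hV : HasChartCovDerivWithinAt I γ V x₀ a S)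
    (hγ : MDifferentiableWithinAt 𝓘(ℝ, ℝ) I γ (Icc 0 1) t) (hS : S ⊆ Icc 0 1)
    (h₀ : γ t ∈ (chartAt H x₀).source) (h₁ : γ t ∈ (chartAt H x₁).source) :
    HasChartCovDerivWithinAt I γ V x₁ a S := by
  refine (hasDerivWithinAt_chartCoord_transition (hγ.continuousWithinAt.mono hS) h₀ h₁
    ((hasDerivWithinAt_extChartAt_comp hγ h₀).mono hS) hV).congr_deriv ?_
  rw [map_sub, fderiv_chartChristoffel h₀ h₁, ← chartCoord_eq_fderiv h₀ h₁,
    ← chartCoord_eq_fderiv h₀ h₁, ← chartCoord_eq_fderiv h₀ h₁]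
  abel

theorem hasCovDerivWithinAt_iff_chart (hγ : MDifferentiableWithinAt 𝓘(ℝ, ℝ) I γ (Icc 0 1) t)
    (hS : S ⊆ Icc 0 1) (h₀ : γ t ∈ (chartAt H x₀).source) :
    HasCovDerivWithinAt I γ V a S ↔ HasChartCovDerivWithinAt I γ V x₀ a S :=
  ⟨fun hV => hV.change_chart hγ hS (mem_chart_source H _) h₀,
    fun hV => hV.change_chart hγ hS h₀ (mem_chart_source H _)⟩

theorem HasCovDerivWithinAt.inner (hV : HasCovDerivWithinAt I γ V a S)
    (hW : HasCovDerivWithinAt I γ W b S)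
    (hγ : MDifferentiableWithinAt 𝓘(ℝ, ℝ) I γ (Icc 0 1) t) (hS : S ⊆ Icc 0 1) :
    HasDerivWithinAt (fun s => ⟪V s, W s⟫_ℝ) (⟪a, W t⟫_ℝ + ⟪V t, b⟫_ℝ) S t := by
  have hp := mem_chart_source H (γ t)
  have hg : DifferentiableAt ℝ (chartMetric I (γ t)) (extChartAt I (γ t) (γ t)) :=
    (contDiffAt_chartMetric (n := 1) hp).differentiableAt one_ne_zero
  have hderiv := hasDerivWithinAt_apply_apply (y := fun s => extChartAt I (γ t) (γ s)) hg
    ((hasDerivWithinAt_extChartAt_comp hγ hp).mono hS) hV hW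
  have hchart := eventually_mem_chartAt_source (hγ.continuousWithinAt.mono hS) hp
  refine (hderiv.congr_of_eventuallyEq
    (hchart.mono fun s hs => inner_eq_chartMetric hs (V s) (W s))
    (inner_eq_chartMetric hp (V t) (W t))).congr_deriv ?_
  rw [inner_eq_chartMetric hp, inner_eq_chartMetric hp,
    ← christoffelForm_add_swap hg (chartMetric_symm (γ t)), map_sub, map_sub, sub_apply,
    chartMetric_chartChristoffel hp, chartMetric_symm _ _ _ (chartChristoffel I _ _ _ _),
    chartMetric_chartChristoffel hp]
  ring

end Along

/-! ### Parallel transport -/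

section ParallelTransport

variable {E : Type*} [NormedAddCommGroup E] [NormedSpace ℝ E]
  {H : Type*} [TopologicalSpace H] {I : ModelWithCorners ℝ E H}
  {M : Type*} [TopologicalSpace M] [ChartedSpace H M] [IsManifold I ∞ M]
  {γ : ℝ → M} {V W : ∀ t, TangentSpace I (γ t)} {t : ℝ} {x₀ : M}

theorem contDiffWithinAt_extChartAt_comp {n : WithTop ℕ∞} [ENat.LEInfty n]
    (hγ : ContMDiffOn 𝓘(ℝ, ℝ) I n γ (Icc 0 1)) (ht : t ∈ Icc (0 : ℝ) 1)
    (h₀ : γ t ∈ (chartAt H x₀).source) :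
    ContDiffWithinAt ℝ n (fun s => extChartAt I x₀ (γ s)) (Icc 0 1) t :=
  ((contMDiffAt_extChartAt' (n := n) h₀).comp_contMDiffWithinAt t (hγ t ht)).contDiffWithinAt

theorem contDiffWithinAt_chartCoord_velocity {m n : WithTop ℕ∞} [ENat.LEInfty n]
    (hmn : m + 1 ≤ n) (hγ : ContMDiffOn 𝓘(ℝ, ℝ) I n γ (Icc 0 1)) (ht : t ∈ Icc (0 : ℝ) 1)
    (h₀ : γ t ∈ (chartAt H x₀).source) :
    ContDiffWithinAt ℝ m (fun s => chartCoord I x₀ (γ s) (velocity I γ s)) (Icc 0 1) t := by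
  have hcoord : ∀ s ∈ Icc (0 : ℝ) 1, γ s ∈ (chartAt H x₀).source →
      chartCoord I x₀ (γ s) (velocity I γ s) =
        fderivWithin ℝ (fun s => extChartAt I x₀ (γ s)) (Icc 0 1) s 1 := fun s hs hs₀ => by
    have hd : MDifferentiableWithinAt 𝓘(ℝ, ℝ) I γ (Icc 0 1) s :=
      (hγ s hs).mdifferentiableWithinAt (by rintro rfl; simp at hmn)
    exact ((hasDerivWithinAt_extChartAt_comp hd hs₀).derivWithin
      (uniqueDiffOn_Icc_zero_one s hs)).symm
  refine (((contDiffWithinAt_extChartAt_comp hγ ht h₀).fderivWithin_right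
    uniqueDiffOn_Icc_zero_one hmn ht).clm_apply
    (contDiffWithinAt_const (c := (1 : ℝ)))).congr_of_eventuallyEq ?_ (hcoord t ht h₀)
  filter_upwards [eventually_mem_chartAt_source (hγ t ht).continuousWithinAt h₀,
    self_mem_nhdsWithin] with s hs₀ hs using hcoord s hs hs₀

variable [RiemannianBundle (fun x : M => TangentSpace I x)]

variable (I) in
/-- `V` is parallel along the part of the curve `γ : [0,1] → M` over `S ⊆ [0,1]`. -/
def IsParallelOn (γ : ℝ → M) (V : ∀ t, TangentSpace I (γ t)) (S : Set ℝ) : Prop :=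
  ∀ t ∈ S, HasCovDerivWithinAt I γ V (0 : TangentSpace I (γ t)) S

variable (I) in
/-- Every tangent vector at a point of `γ` over `[a,b]` extends to a parallel field over `[a,b]`. -/
def HasParallelExtensions (γ : ℝ → M) (a b : ℝ) : Prop :=
  ∀ c ∈ Icc a b, ∀ w : TangentSpace I (γ c),
    ∃ V : ∀ t, TangentSpace I (γ t), V c = w ∧ IsParallelOn I γ V (Icc a b)

theorem IsParallelOn.exists_glue {a b c : ℝ} (hab : a ≤ b) (hbc : b ≤ c)
    (hV : IsParallelOn I γ V (Icc a b)) (hW : IsParallelOn I γ W (Icc b c)) (hVW : V b = W b) :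
    ∃ X : ∀ t, TangentSpace I (γ t), (∀ t ∈ Icc a b, X t = V t) ∧ (∀ t ∈ Icc b c, X t = W t) ∧
      IsParallelOn I γ X (Icc a c) := by
  let X : ∀ t, TangentSpace I (γ t) := fun t => if t ≤ b then V t else W t
  have hXV : ∀ t ∈ Icc a b, X t = V t := fun t ht => if_pos ht.2
  have hXW : ∀ t ∈ Icc b c, X t = W t := fun t ht => by
    rcases ht.1.eq_or_lt with rfl | hlt
    · exact (if_pos le_rfl).trans hVW
    · exact if_neg (not_le.2 hlt)
  have hleft : ∀ t, HasCovDerivWithinAt I γ X (0 : TangentSpace I (γ t)) (Icc a b) := fun t => by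
    by_cases ht : t ∈ Icc a b
    · exact (hV t ht).congr hXV ht
    · exact hasCovDerivWithinAt_of_notMem_Icc ht
  have hright : ∀ t, HasCovDerivWithinAt I γ X (0 : TangentSpace I (γ t)) (Icc b c) := fun t => by
    by_cases ht : t ∈ Icc b c
    · exact (hW t ht).congr hXW ht
    · exact hasCovDerivWithinAt_of_notMem_Icc ht
  refine ⟨X, hXV, hXW, fun t _ => ?_⟩
  rw [← Icc_union_Icc_eq_Icc hab hbc]
  exact (hleft t).union (hright t)

theorem HasParallelExtensions.trans {a b c : ℝ} (hab : a ≤ b) (hbc : b ≤ c)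
    (h₁ : HasParallelExtensions I γ a b) (h₂ : HasParallelExtensions I γ b c) :
    HasParallelExtensions I γ a c := by
  intro r hr w
  rcases le_total r b with hrb | hbr
  · obtain ⟨V, rfl, hV⟩ := h₁ r ⟨hr.1, hrb⟩ w
    obtain ⟨W, hWb, hW⟩ := h₂ b ⟨le_rfl, hbc⟩ (V b)
    obtain ⟨X, hXV, -, hX⟩ := hV.exists_glue hab hbc hW hWb.symm
    exact ⟨X, hXV r ⟨hr.1, hrb⟩, hX⟩
  · obtain ⟨W, rfl, hW⟩ := h₂ r ⟨hbr, hr.2⟩ w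
    obtain ⟨V, hVb, hV⟩ := h₁ b ⟨hab, le_rfl⟩ (W b)
    obtain ⟨X, -, hXW, hX⟩ := hV.exists_glue hab hbc hW hVb
    exact ⟨X, hXW r ⟨hbr, hr.2⟩, hX⟩

variable [CompleteSpace E]

theorem IsParallelAlong.add (hV : IsParallelAlong I γ V) (hW : IsParallelAlong I γ W) :
    IsParallelAlong I γ (fun s => V s + W s) := by
  rw [isParallelAlong_iff] at *
  exact fun t ht => add_zero (0 : TangentSpace I (γ t)) ▸ (hV t ht).add (hW t ht)

theorem IsParallelAlong.const_smul (hV : IsParallelAlong I γ V) (c : ℝ) :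
    IsParallelAlong I γ (fun s => c • V s) := by
  rw [isParallelAlong_iff] at *
  exact fun t ht => smul_zero (A := TangentSpace I (γ t)) c ▸ (hV t ht).const_smul c

variable [I.Boundaryless] [IsContMDiffRiemannianBundle I 1 E (fun x : M => TangentSpace I x)]
  {α β : ℝ}

theorem IsParallelAlong.inner_eq (hV : IsParallelAlong I γ V) (hW : IsParallelAlong I γ W)
    (hγ : MDifferentiableOn 𝓘(ℝ, ℝ) I γ (Icc 0 1)) (hα : α ∈ Icc (0 : ℝ) 1)
    (hβ : β ∈ Icc (0 : ℝ) 1) : ⟪V α, W α⟫_ℝ = ⟪V β, W β⟫_ℝ := by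
  rw [isParallelAlong_iff] at hV hW
  have hderiv : ∀ t ∈ Icc (0 : ℝ) 1, HasDerivWithinAt (fun s => ⟪V s, W s⟫_ℝ) 0 (Icc 0 1) t :=
    fun t ht => ((hV t ht).inner (hW t ht) (hγ t ht) Subset.rfl).congr_deriv
      (by rw [inner_zero_left, inner_zero_right, add_zero])
  have hconst := constant_of_derivWithin_zero
    (fun t ht => (hderiv t ht).differentiableWithinAt)
    (fun t ht => (hderiv t (Ico_subset_Icc_self ht)).derivWithin
      (uniqueDiffOn_Icc_zero_one t (Ico_subset_Icc_self ht)))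
  exact (hconst α hα).trans (hconst β hβ).symm

theorem IsParallelAlong.eq_of_eq (hV : IsParallelAlong I γ V) (hW : IsParallelAlong I γ W)
    (hγ : MDifferentiableOn 𝓘(ℝ, ℝ) I γ (Icc 0 1)) (hα : α ∈ Icc (0 : ℝ) 1)
    (hβ : β ∈ Icc (0 : ℝ) 1) (h : V α = W α) : V β = W β := by
  have hsub := hV.add (hW.const_smul (-1))
  have hnorm := hsub.inner_eq hsub hγ hα hβ
  rw [h, neg_one_smul, add_neg_cancel, inner_zero_left] at hnorm
  have hzero := inner_self_eq_zero.1 hnorm.symm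
  rwa [neg_one_smul, ← sub_eq_add_neg, sub_eq_zero] at hzero

variable (I) in
/-- The coefficient `W ↦ -Γ(W, γ')` of the equation `W' = -Γ(W, γ')` of parallel transport in the
preferred chart around `x₀`. -/
def transportCoeff (γ : ℝ → M) (x₀ : M) (s : ℝ) : E →L[ℝ] E :=
  -(chartChristoffel I x₀ (extChartAt I x₀ (γ s))).flip (chartCoord I x₀ (γ s) (velocity I γ s))

theorem continuousWithinAt_transportCoeff (hγ : ContMDiffOn 𝓘(ℝ, ℝ) I 1 γ (Icc 0 1))
    (ht : t ∈ Icc (0 : ℝ) 1) (h₀ : γ t ∈ (chartAt H x₀).source) :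
    ContinuousWithinAt (transportCoeff I γ x₀) (Icc 0 1) t := by
  have hΓ : ContinuousWithinAt (fun s => chartChristoffel I x₀ (extChartAt I x₀ (γ s)))
      (Icc 0 1) t :=
    ContinuousAt.comp_continuousWithinAt (f := fun s => extChartAt I x₀ (γ s))
      (contDiffAt_chartChristoffel (m := 0) (n := 1) (zero_add 1).le h₀).continuousAt
      (contDiffWithinAt_extChartAt_comp hγ ht h₀).continuousWithinAt
  have hflip := (ContinuousLinearMap.flipₗᵢ ℝ E E E).continuous.continuousAt
    |>.comp_continuousWithinAt hΓ
  exact (hflip.clm_apply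
    (contDiffWithinAt_chartCoord_velocity (zero_add 1).le hγ ht h₀).continuousWithinAt).neg

theorem hasCovDerivWithinAt_chartVec {S : Set ℝ} {F : ℝ → E}
    (hγ : MDifferentiableWithinAt 𝓘(ℝ, ℝ) I γ (Icc 0 1) t) (ht : t ∈ S) (hS : S ⊆ Icc 0 1)
    (hchart : ∀ s ∈ S, γ s ∈ (chartAt H x₀).source)
    (hF : HasDerivWithinAt F (transportCoeff I γ x₀ t (F t)) S t) :
    HasCovDerivWithinAt I γ (fun s => chartVec I x₀ (γ s) (F s)) (0 : TangentSpace I (γ t)) S := by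
  rw [hasCovDerivWithinAt_iff_chart hγ hS (hchart t ht)]
  have hcoord : ∀ s ∈ S, chartCoord I x₀ (γ s) (chartVec I x₀ (γ s) (F s)) = F s :=
    fun s hs => chartCoord_chartVec (hchart s hs) _
  unfold HasChartCovDerivWithinAt
  rw [hcoord t ht, map_zero, zero_sub]
  exact hF.congr_of_mem hcoord ht

theorem exists_nhds_forall_hasParallelExtensions (hγ : ContMDiffOn 𝓘(ℝ, ℝ) I 1 γ (Icc 0 1))
    (ht : t ∈ Icc (0 : ℝ) 1) :
    ∃ O ∈ 𝓝 t, ∀ a b, Icc a b ⊆ Icc 0 1 → Icc a b ⊆ O → HasParallelExtensions I γ a b := by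
  have hchart := eventually_mem_chartAt_source (hγ t ht).continuousWithinAt
    (mem_chart_source H (γ t))
  obtain ⟨O, hO, hODE⟩ := exists_nhds_forall_Icc_hasDerivWithinAt_linear
    (A := transportCoeff I γ (γ t)) (S := Icc 0 1)
    (by filter_upwards [hchart, self_mem_nhdsWithin] with s hs₀ hs
          using continuousWithinAt_transportCoeff hγ hs hs₀) ht
  obtain ⟨O', hO', hchart'⟩ := mem_nhdsWithin_iff_exists_mem_nhds_inter.1 hchart
  refine ⟨O ∩ O', inter_mem hO hO', fun a b hab habO c hc w => ?_⟩
  have hmem : ∀ s ∈ Icc a b, γ s ∈ (chartAt H (γ t)).source :=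
    fun s hs => hchart' ⟨(habO hs).2, hab hs⟩
  obtain ⟨F, hFc, hF⟩ := hODE a b hab (fun s hs => (habO hs).1) c hc (chartCoord I (γ t) (γ c) w)
  refine ⟨fun s => chartVec I (γ t) (γ s) (F s), ?_, fun s hs => ?_⟩
  · simp only [hFc, chartVec_chartCoord (hmem c hc)]
  · exact hasCovDerivWithinAt_chartVec
      ((hγ s (hab hs)).mdifferentiableWithinAt one_ne_zero) hs hab hmem (hF s hs)

theorem exists_isParallelAlong (hγ : ContMDiffOn 𝓘(ℝ, ℝ) I 1 γ (Icc 0 1))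
    (hα : α ∈ Icc (0 : ℝ) 1) (w : TangentSpace I (γ α)) :
    ∃ V : ∀ t, TangentSpace I (γ t), V α = w ∧ IsParallelAlong I γ V := by
  have hext : HasParallelExtensions I γ 0 1 := Icc_induction_of_eventually zero_le_one
    (fun t ht => by
      obtain ⟨O, hO, h⟩ := exists_nhds_forall_hasParallelExtensions hγ ht
      exact ⟨O, hO, fun a b _ => h a b⟩)
    (fun _ _ _ => HasParallelExtensions.trans)
  obtain ⟨V, hVα, hV⟩ := hext α hα w
  exact ⟨V, hVα, isParallelAlong_iff.2 hV⟩

theorem exists_isParallelTransport (hγ : ContMDiffOn 𝓘(ℝ, ℝ) I 1 γ (Icc 0 1))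
    (hα : α ∈ Icc (0 : ℝ) 1) (hβ : β ∈ Icc (0 : ℝ) 1) : ∃ P, IsParallelTransport I γ α β P := by
  have hd : MDifferentiableOn 𝓘(ℝ, ℝ) I γ (Icc 0 1) := hγ.mdifferentiableOn one_ne_zero
  choose F hFα hF using fun w => exists_isParallelAlong (I := I) hγ hα w
  let T : TangentSpace I (γ α) →ₗ[ℝ] TangentSpace I (γ β) :=
    { toFun := fun w => F w β
      map_add' := fun v w => (hF (v + w)).eq_of_eq ((hF v).add (hF w)) hd hα hβ
        (by simp only [hFα])
      map_smul' := fun c w => (hF (c • w)).eq_of_eq ((hF w).const_smul c) hd hα hβ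
        (by simp only [hFα]) }
  have hnorm : ∀ w, ‖T w‖ ≤ 1 * ‖w‖ := fun w => by
    have hinner := (hF w).inner_eq (hF w) hd hβ hα
    rw [hFα, real_inner_self_eq_norm_sq, real_inner_self_eq_norm_sq,
      sq_eq_sq₀ (norm_nonneg _) (norm_nonneg _)] at hinner
    rw [one_mul]
    exact hinner.le
  exact ⟨T.mkContinuous 1 hnorm, fun w => ⟨F w, hF w, hFα w, rfl⟩⟩

theorem isParallelTransport_parallelTransport (hγ : ContMDiffOn 𝓘(ℝ, ℝ) I 1 γ (Icc 0 1))
    (hα : α ∈ Icc (0 : ℝ) 1) (hβ : β ∈ Icc (0 : ℝ) 1) :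
    IsParallelTransport I γ α β (parallelTransport I γ α β) := by
  rw [parallelTransport, dif_pos (exists_isParallelTransport hγ hα hβ)]
  exact (exists_isParallelTransport hγ hα hβ).choose_spec

theorem IsParallelAlong.parallelTransport_eq (hV : IsParallelAlong I γ V)
    (hγ : ContMDiffOn 𝓘(ℝ, ℝ) I 1 γ (Icc 0 1)) (hα : α ∈ Icc (0 : ℝ) 1)
    (hβ : β ∈ Icc (0 : ℝ) 1) : parallelTransport I γ α β (V α) = V β := by
  obtain ⟨W, hW, hWα, hWβ⟩ := isParallelTransport_parallelTransport hγ hα hβ (V α)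
  rw [← hWβ]
  exact hW.eq_of_eq hV (hγ.mdifferentiableOn one_ne_zero) hα hβ hWα

theorem IsParallelAlong.inner_parallelTransport (hV : IsParallelAlong I γ V)
    (hγ : ContMDiffOn 𝓘(ℝ, ℝ) I 1 γ (Icc 0 1)) (hα : α ∈ Icc (0 : ℝ) 1)
    (hβ : β ∈ Icc (0 : ℝ) 1) (w : TangentSpace I (γ α)) :
    ⟪parallelTransport I γ α β w, V β⟫_ℝ = ⟪w, V α⟫_ℝ := by
  obtain ⟨W, hW, rfl, hWβ⟩ := isParallelTransport_parallelTransport hγ hα hβ w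
  rw [← hWβ]
  exact hW.inner_eq hV (hγ.mdifferentiableOn one_ne_zero) hβ hα

end ParallelTransport

/-! ### Geodesics -/

section Geodesics

variable {E : Type*} [NormedAddCommGroup E] [NormedSpace ℝ E]
  {H : Type*} [TopologicalSpace H] {I : ModelWithCorners ℝ E H}
  {M : Type*} [TopologicalSpace M] [ChartedSpace H M]
  {γ γ₁ γ₂ : ℝ → M} {r t : ℝ} {x₀ : M}

variable (I) in
/-- The curve `t ↦ (γ t, γ' t)` in the tangent bundle. -/
def tangentLift (γ : ℝ → M) (t : ℝ) : TangentBundle I M :=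
  ⟨γ t, velocity I γ t⟩

theorem tangentLift_congr (h : EqOn γ₁ γ₂ (Icc 0 1)) :
    EqOn (tangentLift I γ₁) (tangentLift I γ₂) (Icc 0 1) :=
  fun t ht => tangentMapWithin_congr (I := 𝓘(ℝ, ℝ)) (I' := I) h
    (⟨t, (1 : ℝ)⟩ : TangentBundle 𝓘(ℝ, ℝ) ℝ) ht

theorem mapsTo_mul_left_Icc (hr : r ∈ Icc (0 : ℝ) 1) :
    MapsTo (fun s => r * s) (Icc (0 : ℝ) 1) (Icc 0 1) :=
  fun _ hs => unitInterval.mul_mem hr hs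

variable [IsManifold I ∞ M]

variable (I) in
/-- The position and the components of a tangent vector in the preferred chart around `x₀`. -/
def tangentCoord (x₀ : M) (p : TangentBundle I M) : E × E :=
  (extChartAt I x₀ p.1, chartCoord I x₀ p.1 p.2)

theorem tangentCoord_injOn :
    InjOn (tangentCoord I x₀) {p | p.1 ∈ (chartAt H x₀).source} := by
  rintro ⟨p, v⟩ hp ⟨q, w⟩ hq h
  rw [tangentCoord, tangentCoord, Prod.mk.injEq] at h
  have hpq : p = q := (extChartAt I x₀).injOn (by simpa using hp) (by simpa using hq) h.1
  subst hpq
  exact congrArg (TotalSpace.mk p) (chartCoord_injective hp h.2)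

theorem velocity_rescale (hr : r ∈ Icc (0 : ℝ) 1)
    (hγ : MDifferentiableOn 𝓘(ℝ, ℝ) I γ (Icc 0 1)) (ht : t ∈ Icc (0 : ℝ) 1) :
    velocity I (fun s => γ (r * s)) t = r • velocity I γ (r * t) := by
  have hp := mem_chart_source H (γ (r * t))
  have hmaps := mapsTo_mul_left_Icc hr
  have hd : MDifferentiableOn 𝓘(ℝ, ℝ) I (fun s => γ (r * s)) (Icc 0 1) :=
    hγ.comp (fun s _ => (differentiableAt_id.const_mul r).mdifferentiableAt.mdifferentiableWithinAt)
      hmaps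
  refine chartCoord_injective hp ?_
  rw [map_smul]
  exact (uniqueDiffOn_Icc_zero_one t ht).eq_deriv _ (hasDerivWithinAt_extChartAt_comp (hd t ht) hp)
    ((hasDerivWithinAt_extChartAt_comp (hγ _ (hmaps ht)) hp).scomp t
      (hasDerivWithinAt_mul_left r t _) hmaps)

variable [RiemannianBundle (fun x : M => TangentSpace I x)]

theorem HasCovDerivWithinAt.rescale {V : ∀ t, TangentSpace I (γ t)}
    {a : TangentSpace I (γ (r * t))} (hV : HasCovDerivWithinAt I γ V a (Icc 0 1))
    (hγ : MDifferentiableOn 𝓘(ℝ, ℝ) I γ (Icc 0 1)) (hr : r ∈ Icc (0 : ℝ) 1)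
    (ht : t ∈ Icc (0 : ℝ) 1) :
    HasCovDerivWithinAt I (fun s => γ (r * s)) (fun s => V (r * s)) (t := t) (r • a)
      (Icc 0 1) := by
  have hderiv := HasDerivWithinAt.scomp t hV (hasDerivWithinAt_mul_left r t _)
    (mapsTo_mul_left_Icc hr)
  refine hderiv.congr_deriv ?_
  rw [velocity_rescale hr hγ ht, map_smul, map_smul, map_smul, smul_sub]

theorem HasCovDerivWithinAt.congr_velocity
    (h : HasCovDerivWithinAt I γ₁ (velocity I γ₁) (0 : TangentSpace I (γ₁ t)) (Icc 0 1))
    (heq : EqOn γ₂ γ₁ (Icc 0 1)) (ht : t ∈ Icc (0 : ℝ) 1) :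
    HasCovDerivWithinAt I γ₂ (velocity I γ₂) (0 : TangentSpace I (γ₂ t)) (Icc 0 1) := by
  have hcoord : ∀ x₀, ∀ s ∈ Icc (0 : ℝ) 1, chartCoord I x₀ (γ₂ s) (velocity I γ₂ s) =
      chartCoord I x₀ (γ₁ s) (velocity I γ₁ s) := fun x₀ s hs =>
    congrArg (fun p => (tangentCoord I x₀ p).2) (tangentLift_congr heq hs)
  unfold HasCovDerivWithinAt HasChartCovDerivWithinAt at *
  rw [hcoord _ t ht, map_zero, heq ht]
  rw [map_zero] at h
  exact h.congr_of_mem (hcoord _) ht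

variable [CompleteSpace E]

theorem isGeodesic_iff : IsGeodesic I γ ↔ ContMDiffOn 𝓘(ℝ, ℝ) I 2 γ (Icc 0 1) ∧
    IsParallelAlong I γ (velocity I γ) :=
  and_congr_right fun hγ => forall₂_congr fun _ ht => (and_iff_right
    ((contDiffWithinAt_chartCoord_velocity one_add_one_eq_two.le hγ ht
      (mem_chart_source H _)).differentiableWithinAt one_ne_zero)).symm

theorem IsGeodesic.isParallelAlong (h : IsGeodesic I γ) : IsParallelAlong I γ (velocity I γ) :=
  (isGeodesic_iff.1 h).2

theorem IsGeodesic.mdifferentiableOn (h : IsGeodesic I γ) :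
    MDifferentiableOn 𝓘(ℝ, ℝ) I γ (Icc 0 1) :=
  h.1.mdifferentiableOn two_ne_zero

theorem IsGeodesic.hasCovDerivWithinAt (h : IsGeodesic I γ) (ht : t ∈ Icc (0 : ℝ) 1) :
    HasCovDerivWithinAt I γ (velocity I γ) (0 : TangentSpace I (γ t)) (Icc 0 1) :=
  isParallelAlong_iff.1 h.isParallelAlong t ht

theorem IsGeodesic.congr (h : IsGeodesic I γ₁) (heq : EqOn γ₂ γ₁ (Icc 0 1)) :
    IsGeodesic I γ₂ := by
  rw [isGeodesic_iff, isParallelAlong_iff]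
  exact ⟨h.1.congr heq, fun t ht => (h.hasCovDerivWithinAt ht).congr_velocity heq ht⟩

theorem IsGeodesic.rescale (h : IsGeodesic I γ) (hr : r ∈ Icc (0 : ℝ) 1) :
    IsGeodesic I (fun s => γ (r * s)) := by
  have hmaps := mapsTo_mul_left_Icc hr
  rw [isGeodesic_iff, isParallelAlong_iff]
  refine ⟨h.1.comp (contDiff_const.mul contDiff_id).contMDiff.contMDiffOn hmaps, fun t ht => ?_⟩
  have hcov := ((h.hasCovDerivWithinAt (hmaps ht)).rescale h.mdifferentiableOn hr ht).const_smul r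
  rw [smul_zero, smul_zero] at hcov
  exact hcov.congr (fun s hs => velocity_rescale hr h.mdifferentiableOn hs) ht

variable (I) in
/-- The vector field on `E × E` whose integral curves are the geodesics, as curves in the tangent
bundle, in the coordinates `tangentCoord I x₀`. -/
def geodesicField (x₀ : M) (p : E × E) : E × E :=
  (p.2, -chartChristoffel I x₀ p.1 p.2 p.2)

variable [I.Boundaryless]

theorem contDiffAt_geodesicField [IsContMDiffRiemannianBundle I 2 E (fun x : M => TangentSpace I x)]
    {p : TangentBundle I M} (hp : p.1 ∈ (chartAt H x₀).source) :
    ContDiffAt ℝ 1 (geodesicField I x₀) (tangentCoord I x₀ p) := by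
  have hΓ : ContDiffAt ℝ 1 (fun q : E × E => chartChristoffel I x₀ q.1) (tangentCoord I x₀ p) :=
    (contDiffAt_chartChristoffel one_add_one_eq_two.le hp).comp (tangentCoord I x₀ p) contDiffAt_fst
  exact contDiffAt_snd.prodMk ((hΓ.clm_apply contDiffAt_snd).clm_apply contDiffAt_snd).neg

theorem IsGeodesic.hasDerivWithinAt_tangentCoord
    [IsContMDiffRiemannianBundle I 1 E (fun x : M => TangentSpace I x)]
    (h : IsGeodesic I γ) (ht : t ∈ Icc (0 : ℝ) 1) (h₀ : γ t ∈ (chartAt H x₀).source) :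
    HasDerivWithinAt (fun s => tangentCoord I x₀ (tangentLift I γ s))
      (geodesicField I x₀ (tangentCoord I x₀ (tangentLift I γ t))) (Icc 0 1) t := by
  have hγ := h.mdifferentiableOn t ht
  have hvel := (hasCovDerivWithinAt_iff_chart hγ Subset.rfl h₀).1 (h.hasCovDerivWithinAt ht)
  unfold HasChartCovDerivWithinAt at hvel
  rw [map_zero, zero_sub] at hvel
  exact (hasDerivWithinAt_extChartAt_comp hγ h₀).prodMk hvel

variable [IsContMDiffRiemannianBundle I 2 E (fun x : M => TangentSpace I x)]

theorem IsGeodesic.eventuallyEq_tangentLift (h₁ : IsGeodesic I γ₁) (h₂ : IsGeodesic I γ₂)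
    (ht : t ∈ Ico (0 : ℝ) 1) (heq : tangentLift I γ₁ t = tangentLift I γ₂ t) :
    tangentLift I γ₁ =ᶠ[𝓝[≥] t] tangentLift I γ₂ := by
  have ht' : t ∈ Icc (0 : ℝ) 1 := Ico_subset_Icc_self ht
  have hp₁ : γ₁ t ∈ (chartAt H (γ₁ t)).source := mem_chart_source H _
  have hγ : γ₁ t = γ₂ t := congrArg TotalSpace.proj heq
  have hp₂ : γ₂ t ∈ (chartAt H (γ₁ t)).source := hγ ▸ hp₁
  have hchart : ∀ {γ}, IsGeodesic I γ → γ t ∈ (chartAt H (γ₁ t)).source →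
      ∀ᶠ s in 𝓝[Icc 0 1] t, γ s ∈ (chartAt H (γ₁ t)).source :=
    fun h => eventually_mem_chartAt_source (h.1 t ht').continuousWithinAt
  have hODE : ∀ {γ}, IsGeodesic I γ → γ t ∈ (chartAt H (γ₁ t)).source →
      ∀ᶠ s in 𝓝[Icc 0 1] t, HasDerivWithinAt (fun s => tangentCoord I (γ₁ t) (tangentLift I γ s))
        (geodesicField I (γ₁ t) (tangentCoord I (γ₁ t) (tangentLift I γ s))) (Icc 0 1) s :=
    fun h hp => by
      filter_upwards [hchart h hp, self_mem_nhdsWithin] with s hs₀ hs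
        using h.hasDerivWithinAt_tangentCoord hs hs₀
  have hnhds : 𝓝[≥] t ≤ 𝓝[Icc 0 1] t :=
    nhdsWithin_le_iff.2 (mem_of_superset (Icc_mem_nhdsGE ht.2) (Icc_subset_Icc_left ht.1))
  filter_upwards [eventuallyEq_of_hasDerivWithinAt (contDiffAt_geodesicField hp₁) ht (hODE h₁ hp₁)
    (hODE h₂ hp₂) (congrArg _ heq), hnhds (hchart h₁ hp₁), hnhds (hchart h₂ hp₂)] with s hs hs₁ hs₂
    using tangentCoord_injOn hs₁ hs₂ hs

theorem IsGeodesic.tangentLift_eq_of_mem_closure [T2Space M] {S : Set ℝ} (h₁ : IsGeodesic I γ₁)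
    (h₂ : IsGeodesic I γ₂) (hS : S ⊆ Icc 0 1) (heq : EqOn (tangentLift I γ₁) (tangentLift I γ₂) S)
    (ht : t ∈ closure S) : tangentLift I γ₁ t = tangentLift I γ₂ t := by
  have htI : t ∈ Icc (0 : ℝ) 1 := closure_minimal hS isClosed_Icc ht
  have : NeBot (𝓝[S] t) := mem_closure_iff_nhdsWithin_neBot.1 ht
  have hγ : γ₁ t = γ₂ t := tendsto_nhds_unique_of_eventuallyEq
    ((h₁.1 t htI).continuousWithinAt.mono hS) ((h₂.1 t htI).continuousWithinAt.mono hS)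
    (eventually_nhdsWithin_of_forall fun s hs => congrArg TotalSpace.proj (heq hs))
  have hp₁ : γ₁ t ∈ (chartAt H (γ₁ t)).source := mem_chart_source H _
  have hp₂ : γ₂ t ∈ (chartAt H (γ₁ t)).source := hγ ▸ hp₁
  refine tangentCoord_injOn hp₁ hp₂ (tendsto_nhds_unique_of_eventuallyEq
    ((h₁.hasDerivWithinAt_tangentCoord htI hp₁).continuousWithinAt.mono hS)
    ((h₂.hasDerivWithinAt_tangentCoord htI hp₂).continuousWithinAt.mono hS)
    (eventually_nhdsWithin_of_forall fun s hs => congrArg _ (heq hs)))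

theorem IsGeodesic.eqOn_tangentLift [T2Space M] (h₁ : IsGeodesic I γ₁) (h₂ : IsGeodesic I γ₂)
    (h0 : tangentLift I γ₁ 0 = tangentLift I γ₂ 0) :
    EqOn (tangentLift I γ₁) (tangentLift I γ₂) (Icc 0 1) := by
  have hclosed : IsClosed ({t | tangentLift I γ₁ t = tangentLift I γ₂ t} ∩ Icc (0 : ℝ) 1) :=
    isClosed_of_closure_subset fun t ht =>
      ⟨h₁.tangentLift_eq_of_mem_closure h₂ inter_subset_right (fun _ hs => hs.1) ht,
        closure_minimal inter_subset_right isClosed_Icc ht⟩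
  exact hclosed.Icc_subset_of_forall_mem_nhdsWithin h0 fun t ht =>
    nhdsWithin_mono t Ioi_subset_Ici_self (h₁.eventuallyEq_tangentLift h₂ ht.2 ht.1)

end Geodesics

/-! ### The exponential map -/

section ExponentialMap

variable {E : Type*} [NormedAddCommGroup E] [NormedSpace ℝ E] [CompleteSpace E]
  {H : Type*} [TopologicalSpace H] {I : ModelWithCorners ℝ E H}
  {M : Type*} [TopologicalSpace M] [ChartedSpace H M] [IsManifold I ∞ M]
  [RiemannianBundle (fun x : M => TangentSpace I x)]
  {γ : ℝ → M} {r t : ℝ} {x : M} {v : TangentSpace I x}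

theorem expCurve_smul : expCurve I x (r • v) = fun s => expCurve I x v (r * s) :=
  funext fun s => by rw [expCurve, expCurve, smul_smul, mul_comm]

theorem IsGeodesicFrom.rescale (h : IsGeodesicFrom I x v γ) (hr : r ∈ Icc (0 : ℝ) 1) :
    IsGeodesicFrom I x (r • v) (fun s => γ (r * s)) := by
  refine ⟨h.1.rescale hr, ?_⟩
  have hlift : tangentLift I γ (r * 0) = ⟨x, v⟩ := by rw [mul_zero]; exact h.2
  rw [velocity_rescale hr h.1.mdifferentiableOn unitInterval.zero_mem]
  exact congrArg (fun p : TangentBundle I M => (⟨p.1, r • p.2⟩ : TangentBundle I M)) hlift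

variable [T2Space M] [I.Boundaryless]
  [IsContMDiffRiemannianBundle I 2 E (fun x : M => TangentSpace I x)]

theorem IsGeodesicFrom.expMap_smul (h : IsGeodesicFrom I x v γ) (hr : r ∈ Icc (0 : ℝ) 1) :
    expMap I x (r • v) = γ r := by
  have hrescale := h.rescale hr
  have hex : ∃ γ, IsGeodesicFrom I x (r • v) γ := ⟨_, hrescale⟩
  have hlift := hex.choose_spec.1.eqOn_tangentLift hrescale.1
    (hex.choose_spec.2.trans hrescale.2.symm) unitInterval.one_mem
  rw [expMap, dif_pos hex]
  exact (congrArg TotalSpace.proj hlift).trans (congrArg γ (mul_one r))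

theorem isGeodesicFrom_expCurve (hv : v ∈ expDomain I x) :
    IsGeodesicFrom I x v (expCurve I x v) := by
  obtain ⟨γ, hγ⟩ := hv
  have heq : EqOn (expCurve I x v) γ (Icc 0 1) := fun t ht => hγ.expMap_smul ht
  exact ⟨hγ.1.congr heq, (tangentLift_congr heq unitInterval.zero_mem).trans hγ.2⟩

theorem tangentLift_expCurve_zero (hv : v ∈ expDomain I x) :
    tangentLift I (expCurve I x v) 0 = ⟨x, v⟩ :=
  (isGeodesicFrom_expCurve hv).2

theorem tangentLift_expCurve_smul (hv : v ∈ expDomain I x) (hr : r ∈ Icc (0 : ℝ) 1) :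
    tangentLift I (expCurve I x (r • v)) 1 =
      ⟨expCurve I x v r, r • velocity I (expCurve I x v) r⟩ := by
  have hvel := velocity_rescale hr (isGeodesicFrom_expCurve hv).1.mdifferentiableOn
    unitInterval.one_mem
  rw [expCurve_smul, tangentLift, hvel, mul_one]

end ExponentialMap

/-! ### The Taylor estimate -/

section TaylorEstimate

variable {E : Type*} [NormedAddCommGroup E] [NormedSpace ℝ E] [CompleteSpace E]
  {H : Type*} [TopologicalSpace H] {I : ModelWithCorners ℝ E H}
  {M : Type*} [TopologicalSpace M] [ChartedSpace H M]
  [RiemannianBundle (fun x : M => TangentSpace I x)]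
  {γ : ℝ → M} {t : ℝ} {f : M → ℝ}

theorem inner_grad {p : M} (v : TangentSpace I p) :
    ⟪grad I f p, v⟫_ℝ = (mfderiv I 𝓘(ℝ, ℝ) f p : TangentSpace I p →L[ℝ] ℝ) v :=
  InnerProductSpace.toDual_symm_apply

theorem hasDerivWithinAt_comp_curve (hγ : MDifferentiableWithinAt 𝓘(ℝ, ℝ) I γ (Icc 0 1) t)
    (hf : MDifferentiableAt I 𝓘(ℝ, ℝ) f (γ t)) :
    HasDerivWithinAt (fun s => f (γ s)) ⟪grad I f (γ t), velocity I γ t⟫_ℝ (Icc 0 1) t := by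
  have hcomp : HasFDerivWithinAt (fun s => f (γ s))
      ((mfderiv I 𝓘(ℝ, ℝ) f (γ t) : TangentSpace I (γ t) →L[ℝ] ℝ).comp
      (mfderivWithin 𝓘(ℝ, ℝ) I γ (Icc 0 1) t) : ℝ →L[ℝ] ℝ) (Icc 0 1) t :=
    hasMFDerivWithinAt_iff_hasFDerivWithinAt.1
      (hf.hasMFDerivAt.comp_hasMFDerivWithinAt t hγ.hasMFDerivWithinAt)
  have hderiv : ∀ D : ℝ →L[ℝ] ℝ, HasFDerivWithinAt (fun s => f (γ s)) D (Icc 0 1) t →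
      HasDerivWithinAt (fun s => f (γ s)) (D 1) (Icc 0 1) t := fun _ h => h.hasDerivWithinAt
  rw [inner_grad]
  exact hderiv _ hcomp

variable [IsManifold I ∞ M]

variable (I f) in
/-- The quadratic form `⟪Hess f(p) v, v⟫` of the Hessian, as a function of `(p, v)` on the tangent
bundle. -/
def hessQuad (p : TangentBundle I M) : ℝ :=
  ⟪hess I f p.1 p.2, p.2⟫_ℝ

theorem hessQuad_smul {p : M} (c : ℝ) (v : TangentSpace I p) :
    hessQuad I f ⟨p, c • v⟩ = c ^ 2 * hessQuad I f ⟨p, v⟩ := by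
  simp only [hessQuad, map_smul, real_inner_smul_left, real_inner_smul_right]
  ring

variable [I.Boundaryless]

theorem IsGeodesic.hasDerivWithinAt_inner_grad
    [IsContMDiffRiemannianBundle I 1 E (fun x : M => TangentSpace I x)]
    (h : IsGeodesic I γ) (ht : t ∈ Icc (0 : ℝ) 1) (hf : TwiceDifferentiableAt I f (γ t)) :
    HasDerivWithinAt (fun s => ⟪grad I f (γ s), velocity I γ s⟫_ℝ)
      (hessQuad I f (tangentLift I γ t)) (Icc 0 1) t := by
  have hγ := h.mdifferentiableOn t ht
  refine ((hasCovDerivWithinAt_comp hf.2 hγ).inner (h.hasCovDerivWithinAt ht) hγ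
    Subset.rfl).congr_deriv ?_
  rw [inner_zero_right, add_zero]
  rfl

theorem IsGeodesic.abs_hessQuad_sub_le
    [IsContMDiffRiemannianBundle I 1 E (fun x : M => TangentSpace I x)] (h : IsGeodesic I γ) :
    |hessQuad I f (tangentLift I γ 1) - hessQuad I f (tangentLift I γ 0)| ≤
      ‖(parallelTransport I γ 1 0).comp ((hess I f (γ 1)).comp (parallelTransport I γ 0 1))
        - hess I f (γ 0)‖ * ‖velocity I γ 0‖ ^ 2 := by
  have hγ : ContMDiffOn 𝓘(ℝ, ℝ) I 1 γ (Icc 0 1) := h.1.of_le one_le_two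
  have h0 : (0 : ℝ) ∈ Icc (0 : ℝ) 1 := unitInterval.zero_mem
  have h1 : (1 : ℝ) ∈ Icc (0 : ℝ) 1 := unitInterval.one_mem
  set D := (parallelTransport I γ 1 0).comp ((hess I f (γ 1)).comp (parallelTransport I γ 0 1))
    - hess I f (γ 0) with hD
  have hquad : hessQuad I f (tangentLift I γ 1) - hessQuad I f (tangentLift I γ 0) =
      ⟪D (velocity I γ 0), velocity I γ 0⟫_ℝ := by
    rw [hD, sub_apply, inner_sub_left, ContinuousLinearMap.comp_apply,
      ContinuousLinearMap.comp_apply, h.isParallelAlong.parallelTransport_eq hγ h0 h1,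
      h.isParallelAlong.inner_parallelTransport hγ h1 h0]
    rfl
  calc |hessQuad I f (tangentLift I γ 1) - hessQuad I f (tangentLift I γ 0)|
      = |⟪D (velocity I γ 0), velocity I γ 0⟫_ℝ| := by rw [hquad]
    _ ≤ ‖D (velocity I γ 0)‖ * ‖velocity I γ 0‖ := abs_real_inner_le_norm _ _
    _ ≤ ‖D‖ * ‖velocity I γ 0‖ * ‖velocity I γ 0‖ := by gcongr; exact D.le_opNorm _
    _ = ‖D‖ * ‖velocity I γ 0‖ ^ 2 := by ring

variable [T2Space M] [IsContMDiffRiemannianBundle I 2 E (fun x : M => TangentSpace I x)]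
  {x : M} {v : TangentSpace I x} {U : Set M} {L : ℝ}

theorem HessLipschitzAt.abs_hessQuad_sub_le (hL : HessLipschitzAt I f U L x)
    (hv : v ∈ expDomain I x) (hU : ∀ t ∈ Icc (0 : ℝ) 1, expCurve I x v t ∈ U) :
    |hessQuad I f (tangentLift I (expCurve I x v) 1) - hessQuad I f ⟨x, v⟩| ≤ L * ‖v‖ ^ 3 := by
  have hlift := tangentLift_expCurve_zero hv
  have hnorm : ‖velocity I (expCurve I x v) 0‖ = ‖v‖ :=
    congrArg (fun p : TangentBundle I M => ‖p.2‖) hlift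
  have hquad := (isGeodesicFrom_expCurve hv).1.abs_hessQuad_sub_le (f := f)
  rw [hlift, hnorm] at hquad
  calc _ ≤ _ := hquad
    _ ≤ L * ‖v‖ * ‖v‖ ^ 2 := by gcongr; exact hL v hv hU
    _ = L * ‖v‖ ^ 3 := by ring

theorem HessLipschitzAt.abs_hessQuad_expCurve_sub_le (hL : HessLipschitzAt I f U L x)
    (hv : v ∈ expDomain I x) (hU : ∀ t ∈ Icc (0 : ℝ) 1, expCurve I x v t ∈ U)
    (ht : t ∈ Icc (0 : ℝ) 1) :
    |hessQuad I f (tangentLift I (expCurve I x v) t) - hessQuad I f ⟨x, v⟩| ≤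
      L * ‖v‖ ^ 3 * t := by
  rcases ht.1.eq_or_lt with rfl | hpos
  · rw [tangentLift_expCurve_zero hv, sub_self, abs_zero, mul_zero]
  have hbound := hL.abs_hessQuad_sub_le (v := t • v)
    ⟨_, (isGeodesicFrom_expCurve hv).rescale ht⟩ fun s hs => by
      rw [expCurve_smul]
      exact hU _ (mapsTo_mul_left_Icc ht hs)
  rw [tangentLift_expCurve_smul hv ht, hessQuad_smul, hessQuad_smul, ← mul_sub, abs_mul,
    abs_of_pos (pow_pos hpos 2), norm_smul, Real.norm_of_nonneg ht.1] at hbound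
  exact le_of_mul_le_mul_left (hbound.trans_eq (by ring)) (pow_pos hpos 2)

end TaylorEstimate

end RiemTaylor

end

open RiemTaylor in
theorem theorem2p4_general
    {E : Type*} [NormedAddCommGroup E] [NormedSpace ℝ E] [CompleteSpace E]
    {H : Type*} [TopologicalSpace H] {I : ModelWithCorners ℝ E H} [I.Boundaryless]
    {M : Type*} [TopologicalSpace M] [T2Space M] [ChartedSpace H M] [IsManifold I ∞ M]
    [RiemannianBundle (fun x : M => TangentSpace I x)]
    [IsContMDiffRiemannianBundle I 2 E (fun x : M => TangentSpace I x)]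
    {U : Set M} {f : M → ℝ} (hf : ∀ p ∈ U, TwiceDifferentiableAt I f p)
    {L : ℝ} {x : M} (hL : HessLipschitzAt I f U L x) {v : TangentSpace I x}
    (hv : v ∈ expDomain I x) (hU : ∀ t ∈ Icc (0 : ℝ) 1, expCurve I x v t ∈ U) :
    |f (expMap I x v) - f x - ⟪grad I f x, v⟫_ℝ - 1 / 2 * ⟪hess I f x v, v⟫_ℝ|
      ≤ L / 6 * ‖v‖ ^ 3 := by
  set c := expCurve I x v
  have hc : IsGeodesic I c := (isGeodesicFrom_expCurve hv).1
  have hlift : tangentLift I c 0 = ⟨x, v⟩ := tangentLift_expCurve_zero hv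
  have hc1 : c 1 = expMap I x v := congrArg (expMap I x) (one_smul ℝ v)
  have hφ : ∀ t ∈ Icc (0 : ℝ) 1,
      HasDerivWithinAt (fun s => f (c s)) ⟪grad I f (c t), velocity I c t⟫_ℝ (Icc 0 1) t :=
    fun t ht => hasDerivWithinAt_comp_curve (hc.mdifferentiableOn t ht)
      (hf _ (hU t ht)).1.self_of_nhds
  have hφ' : ∀ t ∈ Icc (0 : ℝ) 1, HasDerivWithinAt (fun s => ⟪grad I f (c s), velocity I c s⟫_ℝ)
      (hessQuad I f (tangentLift I c t)) (Icc 0 1) t :=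
    fun t ht => hc.hasDerivWithinAt_inner_grad ht (hf _ (hU t ht))
  have hφ'' : ∀ t ∈ Icc (0 : ℝ) 1, ‖hessQuad I f (tangentLift I c t) -
      hessQuad I f (tangentLift I c 0)‖ ≤ L * ‖v‖ ^ 3 * (t - 0) := fun t ht => by
    rw [hlift, sub_zero]
    exact hL.abs_hessQuad_expCurve_sub_le hv hU ht
  have hinit : f (c 0) + ⟪grad I f (c 0), velocity I c 0⟫_ℝ
        + 1 / 2 * hessQuad I f (tangentLift I c 0)
      = f x + ⟪grad I f x, v⟫_ℝ + 1 / 2 * ⟪hess I f x v, v⟫_ℝ :=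
    congrArg (fun p : TangentBundle I M => f p.1 + ⟪grad I f p.1, p.2⟫_ℝ + 1 / 2 * hessQuad I f p)
      hlift
  calc |f (expMap I x v) - f x - ⟪grad I f x, v⟫_ℝ - 1 / 2 * ⟪hess I f x v, v⟫_ℝ|
      = ‖f (c 1) - f (c 0) - ((1 : ℝ) - 0) • ⟪grad I f (c 0), velocity I c 0⟫_ℝ -
          (((1 : ℝ) - 0) ^ 2 / 2) • hessQuad I f (tangentLift I c 0)‖ := by
        rw [hc1, Real.norm_eq_abs, smul_eq_mul, smul_eq_mul]
        congr 1
        linear_combination hinit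
    _ ≤ L * ‖v‖ ^ 3 / 6 * (1 - 0) ^ 3 :=
        norm_sub_taylor_two_le hφ hφ' hφ'' (right_mem_Icc.2 zero_le_one)
    _ = L / 6 * ‖v‖ ^ 3 := by ring

open RiemTaylor in
theorem theorem2p4
    {E : Type*} [NormedAddCommGroup E] [NormedSpace ℝ E] [CompleteSpace E]
    {H : Type*} [TopologicalSpace H] (I : ModelWithCorners ℝ E H) [I.Boundaryless]
    {M : Type*} [TopologicalSpace M] [T2Space M] [ChartedSpace H M] [IsManifold I ∞ M]
    [RiemannianBundle (fun x : M => TangentSpace I x)]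
    [IsContMDiffRiemannianBundle I ∞ E (fun x : M => TangentSpace I x)]
    (U : Set M) (f : M → ℝ) (hf : ∀ p ∈ U, TwiceDifferentiableAt I f p)
    (L : ℝ) (x : M) (hx : x ∈ U) (hL : HessLipschitzAt I f U L x) :
    (∀ v ∈ expDomain I x, (∀ t ∈ Icc (0 : ℝ) 1, expMap I x (t • v) ∈ U) →
      |f (expMap I x v) - f x - ⟪grad I f x, v⟫_ℝ - 1 / 2 * ⟪hess I f x v, v⟫_ℝ|
        ≤ L / 6 * ‖v‖ ^ 3) ∧
    (IsGeodesicallyConvex I U → ∀ v ∈ expDomain I x, expMap I x v ∈ U →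
      |f (expMap I x v) - f x - ⟪grad I f x, v⟫_ℝ - 1 / 2 * ⟪hess I f x v, v⟫_ℝ|
        ≤ L / 6 * ‖v‖ ^ 3) :=
  ⟨fun _ hv hU => theorem2p4_general hf hL hv hU,
    fun hconv v hv hvU => theorem2p4_general hf hL hv (hconv x hx v hv hvU)⟩
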